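/- Theorem 3 (eventual compactness of the closed-loop semigroup). Let $0<L<\infty$, $\lambda>0$, and let $X=\mathbb{R}\times L^1(0,L)$ with the norm $\|(p_0,p_1)\|_X=|p_0|+\|p_1\|_{L^1}$. Let $P^*=(p_0^*,p_1^*)\in X$ be a nonnegative state with $$p_0^*+\int_0^L p_1^*(x)\,dx=1,\qquad p_1^*\in W^{1,1}(0,L),\qquad p_1^*(0)=\lambda p_0^*,\qquad p_1^*(L)=0,$$ $p_1^*(x)>0$ for all $x\in(0,L)$ and $\frac{dp_1^*}{dx}(x)<0$ for almost every $x\in(0,L)$ (where $p_1^*$ denotes the continuous representative on $[0,L]$). Put $g(x)=1/p_1^*(x)$ and define the operator $\mathcal{A}$ on $X$ by $$\mathcal{A}\begin{pmatrix}p_0\\p_1\end{pmatrix}=\begin{pmatrix}\int_0^L\frac{d}{dx}\big(g(x)p_1(x)\big)\,dx\\[2pt]-\frac{d}{dx}\big(g(x)p_1(x)\big)\end{pmatrix},\qquad D(\mathcal{A})=\{(p_0,p_1)\in X:\ g p_1\in W^{1,1}(0,L),\ p_1(0)=\lambda p_0\}.$$ Then $\mathcal{A}$ is the infinitesimal generator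 of a unique $C_0$-semigroup $(T(t))_{t\ge 0}$ on $X$, and $T(t)$ is a compact operator for every $t>\max\{L,\|p_1^*\|_{L^1(0,L)}\}$. -/

import Mathlib

open MeasureTheory Set Filter Topology
open scoped ContDiff NNReal

/-! ### Semigroups of operators -/

/-- A `C₀`-semigroup (strongly continuous one-parameter semigroup of bounded linear operators)
on a real normed space. -/
@[ext]
structure C0Semigroup (X : Type*) [NormedAddCommGroup X] [NormedSpace ℝ X] where
  /-- the operators `T(t)`, `t ≥ 0` -/
  op : ℝ≥0 → X →L[ℝ] X
  op_zero : op 0 = ContinuousLinearMap.id ℝ X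
  op_add : ∀ s t : ℝ≥0, op (s + t) = (op s).comp (op t)
  strong_continuity : ∀ x : X, Tendsto (fun t : ℝ≥0 => op t x) (𝓝 0) (𝓝 x)

/-- `A` is the infinitesimal generator of `T`: a vector `x` lies in the domain of `A` if and only
if `(T(h) x - x) / h` converges as `h → 0+`, and then `A x` is the limit. -/
def C0Semigroup.IsGeneratedBy {X : Type*} [NormedAddCommGroup X] [NormedSpace ℝ X]
    (T : C0Semigroup X) (A : X →ₗ.[ℝ] X) : Prop :=
  ∀ x y : X, (∃ hx : x ∈ A.domain, A ⟨x, hx⟩ = y) ↔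
    Tendsto (fun h : ℝ≥0 => (h : ℝ)⁻¹ • (T.op h x - x)) (𝓝[>] 0) (𝓝 y)

/-! ### The Sobolev space `W^{1,1}(0, L)` -/

/-- `v` is a weak derivative of `f` on the open interval `(0, L)`. -/
def HasWeakDeriv (L : ℝ) (f v : ℝ → ℝ) : Prop :=
  ∀ φ : ℝ → ℝ, ContDiff ℝ ∞ φ → HasCompactSupport φ → tsupport φ ⊆ Ioo 0 L →
    ∫ x in Ioo 0 L, f x * deriv φ x = - ∫ x in Ioo 0 L, v x * φ x

/-- `f ∈ W^{1,1}(0, L)`: `f` is integrable on `(0, L)` and has an integrable weak derivative. -/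
def MemW11 (L : ℝ) (f : ℝ → ℝ) : Prop :=
  IntegrableOn f (Ioo 0 L) ∧ ∃ v : ℝ → ℝ, IntegrableOn v (Ioo 0 L) ∧ HasWeakDeriv L f v

/-- A weak derivative of a function of `W^{1,1}(0, L)` (unique almost everywhere on `(0, L)`);
zero if `f` is not in `W^{1,1}(0, L)`. -/
noncomputable def weakDeriv (L : ℝ) (f : ℝ → ℝ) : ℝ → ℝ :=
  open Classical in if h : MemW11 L f then h.2.choose else 0

/-- The function `f` on `(0, L)` has a representative that is continuous on `[0, L]` and takes
the value `c` at `0`. -/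
def HasValueAtZero (L : ℝ) (f : ℝ → ℝ) (c : ℝ) : Prop :=
  ∃ w : ℝ → ℝ, ContinuousOn w (Icc 0 L) ∧ f =ᵐ[volume.restrict (Ioo 0 L)] w ∧ w 0 = c

theorem MemW11.integrableOn_weakDeriv {L : ℝ} {f : ℝ → ℝ} (h : MemW11 L f) :
    IntegrableOn (weakDeriv L f) (Ioo 0 L) := by
  rw [weakDeriv, dif_pos h]; exact h.2.choose_spec.1

theorem MemW11.hasWeakDeriv {L : ℝ} {f : ℝ → ℝ} (h : MemW11 L f) :
    HasWeakDeriv L f (weakDeriv L f) := by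
  rw [weakDeriv, dif_pos h]; exact h.2.choose_spec.2

theorem integrableOn_mul_test {L : ℝ} {f φ : ℝ → ℝ} (hf : IntegrableOn f (Ioo 0 L))
    (hφ : Continuous φ) (hc : HasCompactSupport φ) :
    IntegrableOn (fun x => f x * φ x) (Ioo 0 L) := by
  obtain ⟨C, hC⟩ := hc.exists_bound_of_continuous hφ
  exact hf.mul_bdd (c := C) hφ.aestronglyMeasurable (Eventually.of_forall hC)

theorem HasWeakDeriv.add {L : ℝ} {f₁ f₂ v₁ v₂ : ℝ → ℝ}
    (hf₁ : IntegrableOn f₁ (Ioo 0 L)) (hf₂ : IntegrableOn f₂ (Ioo 0 L))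
    (hv₁ : IntegrableOn v₁ (Ioo 0 L)) (hv₂ : IntegrableOn v₂ (Ioo 0 L))
    (h₁ : HasWeakDeriv L f₁ v₁) (h₂ : HasWeakDeriv L f₂ v₂) :
    HasWeakDeriv L (fun x => f₁ x + f₂ x) (fun x => v₁ x + v₂ x) := by
  intro φ hφ hc hs
  have hd : Continuous (deriv φ) := hφ.continuous_deriv (by simp)
  simp only [add_mul]
  rw [integral_add (integrableOn_mul_test hf₁ hd hc.deriv) (integrableOn_mul_test hf₂ hd hc.deriv),
    integral_add (integrableOn_mul_test hv₁ hφ.continuous hc)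
      (integrableOn_mul_test hv₂ hφ.continuous hc), h₁ φ hφ hc hs, h₂ φ hφ hc hs]
  ring

theorem HasWeakDeriv.const_mul {L : ℝ} {f v : ℝ → ℝ} (h : HasWeakDeriv L f v) (c : ℝ) :
    HasWeakDeriv L (fun x => c * f x) (fun x => c * v x) := by
  intro φ hφ hc hs
  simp only [mul_assoc]
  rw [integral_const_mul, integral_const_mul, h φ hφ hc hs]
  ring

theorem HasWeakDeriv.congr {L : ℝ} {f₁ f₂ v : ℝ → ℝ} (h : HasWeakDeriv L f₁ v)
    (hf : f₁ =ᵐ[volume.restrict (Ioo 0 L)] f₂) : HasWeakDeriv L f₂ v := by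
  intro φ hφ hc hs
  rw [← h φ hφ hc hs]
  apply integral_congr_ae
  filter_upwards [hf] with x hx
  rw [hx]

theorem HasWeakDeriv.unique {L : ℝ} {f v₁ v₂ : ℝ → ℝ}
    (hv₁ : IntegrableOn v₁ (Ioo 0 L)) (hv₂ : IntegrableOn v₂ (Ioo 0 L))
    (h₁ : HasWeakDeriv L f v₁) (h₂ : HasWeakDeriv L f v₂) :
    v₁ =ᵐ[volume.restrict (Ioo 0 L)] v₂ := by
  have key := isOpen_Ioo.ae_eq_zero_of_integral_contDiff_smul_eq_zero (μ := volume)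
    (U := Ioo 0 L) (f := fun x => v₁ x - v₂ x) (hv₁.sub hv₂).locallyIntegrableOn ?_
  · rw [Filter.EventuallyEq, ae_restrict_iff' measurableSet_Ioo]
    filter_upwards [key] with x hx hxU
    exact sub_eq_zero.1 (hx hxU)
  · intro φ hφ hc hs
    have e : ∫ x in Ioo 0 L, (v₁ x * φ x - v₂ x * φ x) = 0 := by
      rw [integral_sub (integrableOn_mul_test hv₁ hφ.continuous hc)
        (integrableOn_mul_test hv₂ hφ.continuous hc)]
      have a₁ := h₁ φ hφ hc hs
      have a₂ := h₂ φ hφ hc hs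
      linarith
    rw [← e, ← setIntegral_eq_integral_of_forall_compl_eq_zero (s := Ioo 0 L)]
    · congr 1
      ext x
      simp only [smul_eq_mul]
      ring
    · intro x hx
      have : φ x = 0 := image_eq_zero_of_notMem_tsupport fun h => hx (hs h)
      simp [this]

theorem MemW11.congr {L : ℝ} {f₁ f₂ : ℝ → ℝ} (h : MemW11 L f₁)
    (hf : f₁ =ᵐ[volume.restrict (Ioo 0 L)] f₂) : MemW11 L f₂ :=
  ⟨h.1.congr hf, _, h.integrableOn_weakDeriv, h.hasWeakDeriv.congr hf⟩

theorem MemW11.add {L : ℝ} {f₁ f₂ : ℝ → ℝ} (h₁ : MemW11 L f₁) (h₂ : MemW11 L f₂) :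
    MemW11 L (fun x => f₁ x + f₂ x) :=
  ⟨h₁.1.add h₂.1, _, h₁.integrableOn_weakDeriv.add h₂.integrableOn_weakDeriv,
    h₁.hasWeakDeriv.add h₁.1 h₂.1 h₁.integrableOn_weakDeriv h₂.integrableOn_weakDeriv
      h₂.hasWeakDeriv⟩

theorem MemW11.const_mul {L : ℝ} {f : ℝ → ℝ} (h : MemW11 L f) (c : ℝ) :
    MemW11 L (fun x => c * f x) :=
  ⟨h.1.const_mul c, _, h.integrableOn_weakDeriv.const_mul c, h.hasWeakDeriv.const_mul c⟩

theorem memW11_zero (L : ℝ) : MemW11 L (fun _ => 0) :=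
  ⟨integrableOn_zero, fun _ => 0, integrableOn_zero, fun φ _ _ _ => by simp⟩

/-! ### The state space and the closed-loop operator -/

/-- The space `L¹(0, L)`. -/
abbrev L1Space (L : ℝ) : Type := Lp ℝ 1 (volume.restrict (Ioo 0 L))

/-- The state space `X = ℝ × L¹(0, L)` with the norm `‖(p₀, p₁)‖ = |p₀| + ‖p₁‖_{L¹}`. -/
abbrev StateSpace (L : ℝ) : Type := WithLp 1 (ℝ × L1Space L)

/-- The function `g p₁`, where `g = 1 / p₁*` and `P = (p₀, p₁)`. -/
noncomputable def gMul (L : ℝ) (p1s : ℝ → ℝ) (P : StateSpace L) : ℝ → ℝ :=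
  fun x => 1 / p1s x * (P.snd : ℝ → ℝ) x

theorem gMul_add {L : ℝ} (p1s : ℝ → ℝ) (P Q : StateSpace L) :
    (fun x => gMul L p1s P x + gMul L p1s Q x)
      =ᵐ[volume.restrict (Ioo 0 L)] gMul L p1s (P + Q) := by
  filter_upwards [Lp.coeFn_add P.snd Q.snd] with x hx
  simp only [gMul, WithLp.add_snd, hx, Pi.add_apply]
  ring

theorem gMul_smul {L : ℝ} (p1s : ℝ → ℝ) (c : ℝ) (P : StateSpace L) :
    (fun x => c * gMul L p1s P x) =ᵐ[volume.restrict (Ioo 0 L)] gMul L p1s (c • P) := by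
  filter_upwards [Lp.coeFn_smul c P.snd] with x hx
  simp only [gMul, WithLp.smul_snd, hx, Pi.smul_apply, smul_eq_mul]
  ring

theorem gMul_zero {L : ℝ} (p1s : ℝ → ℝ) :
    (fun _ => 0) =ᵐ[volume.restrict (Ioo 0 L)] gMul L p1s (0 : StateSpace L) := by
  filter_upwards [Lp.coeFn_zero ℝ 1 (volume.restrict (Ioo 0 L))] with x hx
  simp only [gMul, WithLp.zero_snd, hx, Pi.zero_apply, mul_zero]

theorem weakDeriv_gMul_add {L : ℝ} {p1s : ℝ → ℝ} {P Q : StateSpace L}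
    (hP : MemW11 L (gMul L p1s P)) (hQ : MemW11 L (gMul L p1s Q)) :
    weakDeriv L (gMul L p1s (P + Q)) =ᵐ[volume.restrict (Ioo 0 L)]
      fun x => weakDeriv L (gMul L p1s P) x + weakDeriv L (gMul L p1s Q) x := by
  have h := (hP.add hQ).congr (gMul_add p1s P Q)
  exact h.hasWeakDeriv.unique h.integrableOn_weakDeriv
    (hP.integrableOn_weakDeriv.add hQ.integrableOn_weakDeriv)
    ((hP.hasWeakDeriv.add hP.1 hQ.1 hP.integrableOn_weakDeriv hQ.integrableOn_weakDeriv
      hQ.hasWeakDeriv).congr (gMul_add p1s P Q))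

theorem weakDeriv_gMul_smul {L : ℝ} {p1s : ℝ → ℝ} {P : StateSpace L} (c : ℝ)
    (hP : MemW11 L (gMul L p1s P)) :
    weakDeriv L (gMul L p1s (c • P)) =ᵐ[volume.restrict (Ioo 0 L)]
      fun x => c * weakDeriv L (gMul L p1s P) x := by
  have h := (hP.const_mul c).congr (gMul_smul p1s c P)
  exact h.hasWeakDeriv.unique h.integrableOn_weakDeriv (hP.integrableOn_weakDeriv.const_mul c)
    ((hP.hasWeakDeriv.const_mul c).congr (gMul_smul p1s c P))

/-- The domain `{P ∈ X : g p₁ ∈ W^{1,1}(0, L), p₁(0) = λ p₀}` of the closed-loop operator. -/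
noncomputable def closedLoopDomain (L lam : ℝ) (p1s : ℝ → ℝ) : Submodule ℝ (StateSpace L) where
  carrier := {P | MemW11 L (gMul L p1s P) ∧ HasValueAtZero L P.snd (lam * P.fst)}
  add_mem' := by
    rintro P Q ⟨hP, w₁, hw₁, hP', h₁⟩ ⟨hQ, w₂, hw₂, hQ', h₂⟩
    refine ⟨(hP.add hQ).congr (gMul_add p1s P Q), fun x => w₁ x + w₂ x, hw₁.add hw₂, ?_, ?_⟩
    · filter_upwards [hP', hQ', Lp.coeFn_add P.snd Q.snd] with x a b c
      simp only [WithLp.add_snd, c, Pi.add_apply, a, b]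
    · simp only [h₁, h₂, WithLp.add_fst]
      ring
  zero_mem' := by
    refine ⟨(memW11_zero L).congr (gMul_zero p1s), fun _ => 0, continuousOn_const, ?_, ?_⟩
    · filter_upwards [Lp.coeFn_zero ℝ 1 (volume.restrict (Ioo 0 L))] with x hx
      simp only [WithLp.zero_snd, hx, Pi.zero_apply]
    · simp
  smul_mem' := by
    rintro c P ⟨hP, w, hw, hP', h⟩
    refine ⟨(hP.const_mul c).congr (gMul_smul p1s c P), fun x => c * w x,
      continuousOn_const.mul hw, ?_, ?_⟩
    · filter_upwards [hP', Lp.coeFn_smul c P.snd] with x a b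
      simp only [WithLp.smul_snd, b, Pi.smul_apply, a, smul_eq_mul]
    · simp only [h, WithLp.smul_fst, smul_eq_mul]
      ring

/-- The closed-loop operator
`𝒜 (p₀, p₁) = (∫₀ᴸ (g p₁)' dx, -(g p₁)')`, `g = 1 / p₁*`, on `closedLoopDomain`. -/
noncomputable def closedLoopOperator (L lam : ℝ) (p1s : ℝ → ℝ) :
    StateSpace L →ₗ.[ℝ] StateSpace L where
  domain := closedLoopDomain L lam p1s
  toFun :=
    { toFun := fun P => WithLp.toLp 1
        (∫ x in Ioo 0 L, weakDeriv L (gMul L p1s P) x,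
          -(memLp_one_iff_integrable.2 P.2.1.integrableOn_weakDeriv).toLp
            (weakDeriv L (gMul L p1s P)))
      map_add' := by
        intro P Q
        have h := weakDeriv_gMul_add P.2.1 Q.2.1
        rw [← WithLp.toLp_add, Prod.mk_add_mk, ← neg_add]
        congr 3
        · rw [← integral_add P.2.1.integrableOn_weakDeriv Q.2.1.integrableOn_weakDeriv]
          exact integral_congr_ae h
        · rw [← MemLp.toLp_add, MemLp.toLp_eq_toLp_iff]
          exact h
      map_smul' := by
        intro c P
        have h := weakDeriv_gMul_smul c P.2.1
        rw [RingHom.id_apply, ← WithLp.toLp_smul, Prod.smul_mk, smul_neg]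
        congr 3
        · rw [← integral_smul]
          exact integral_congr_ae h
        · rw [← MemLp.toLp_const_smul, MemLp.toLp_eq_toLp_iff]
          exact h }

/-- `(p₀*, p₁*)` is an admissible desired distribution: a nonnegative state of norm one with
`p₁* ∈ W^{1,1}(0, L)` (given by its continuous representative on `[0, L]`), `p₁*(0) = λ p₀*`,
`p₁*(L) = 0`, and `p₁* > 0`, `dp₁*/dx < 0` on `(0, L)`. -/
structure IsDesiredState (L lam p0s : ℝ) (p1s : ℝ → ℝ) : Prop where
  nonneg : 0 ≤ p0s
  mass_one : p0s + ∫ x in Ioo 0 L, p1s x = 1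
  memW11 : MemW11 L p1s
  continuousOn : ContinuousOn p1s (Icc 0 L)
  value_zero : p1s 0 = lam * p0s
  value_L : p1s L = 0
  pos : ∀ x ∈ Ioo 0 L, 0 < p1s x
  deriv_neg : ∀ᵐ x ∂(volume.restrict (Ioo 0 L)), weakDeriv L p1s x < 0

/-!
With the travel time `τ(x) = ∫₀ˣ p₁*` as coordinate and the flux `q = g p₁` as unknown, the equation
`∂ₜ p₁ = -∂ₓ (g p₁)` becomes transport at unit speed on `(0, M)`, `M = ‖p₁*‖_{L¹}`, and
`p₁ ↦ q` is an isometry `L¹(0, L) ≃ L¹(0, M)` (`travelTimeEquiv`). In these coordinates the graph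
of the closed-loop operator consists of the pairs `((p₀, q), (z₀, z₁))` with `z₀ = -∫ z₁` and
`q(y) = κ p₀ - ∫₀ʸ z₁`, where `κ = 1 / p₀*` (`closedLoop_graph_iff`, `graph_stateEquiv_iff`).

The evolution is explicit up to time `M`. The profile `q` records the inlet flux of the last `M`
units of time, so `p₀' = (inlet flux at time t - M) - κ p₀` is solved by variation of constants
(`atomMass`), and the profile at time `t` is `y ↦ inletFlux (t - y)` (`localOp`). This family obeys
the semigroup law up to time `M`, and powers of its value at `M` extend it to a `C₀`-semigroup
(`C0Semigroup.ofLocal`).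

The generator is identified on difference quotients. If they converge, conservation of mass and the
Lebesgue differentiation theorem put the state in the graph (`graph_of_tendsto_quotient`). If the
state is in the graph, its inlet flux is absolutely continuous through time zero, and difference
quotients of a primitive converge in `L¹` (`tendsto_quotient_of_graph`).

A generator determines its semigroup (`C0Semigroup.eq_of_isGeneratedBy`). After the time `M` the
initial profile has left, and the new one consists of the values of `κ p₀` on `[0, M]`, a function
whose derivative is bounded in `L¹` by the initial state. Sampling it on a grid shows that transport
over the time `M` is a norm limit of finite-rank operators (`isCompactOperator_localOp`), so the
semigroup is compact from time `M` on.
-/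

/-! ### Extending a local semigroup -/

/-- The extension to all times of a family `S` that satisfies the semigroup law up to time `M`:
after `n = ⌊t / M⌋` full periods, it acts by `S` for the remaining time. -/
noncomputable def extendOp {R : Type*} [Monoid R] (S : ℝ → R) (M t : ℝ) : R :=
  S M ^ ⌊t / M⌋₊ * S (t - ⌊t / M⌋₊ * M)

section Extend

variable {R : Type*} [Monoid R] {S : ℝ → R} {M : ℝ}

theorem extendOp_of_eq (hM : 0 < M) {t r : ℝ} {n : ℕ} (h0 : 0 ≤ r) (hr : r < M)
    (ht : t = n * M + r) : extendOp S M t = S M ^ n * S r := by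
  have hf : ⌊t / M⌋₊ = n := by
    rw [Nat.floor_eq_iff (by rw [ht]; positivity), le_div_iff₀ hM, div_lt_iff₀ hM]
    constructor <;> nlinarith
  rw [extendOp, hf, ht]
  congr 2
  ring

theorem exists_eq_nat_mul_add (hM : 0 < M) {t : ℝ} (ht : 0 ≤ t) :
    ∃ (n : ℕ) (r : ℝ), 0 ≤ r ∧ r < M ∧ t = n * M + r := by
  refine ⟨⌊t / M⌋₊, t - ⌊t / M⌋₊ * M, ?_, ?_, by ring⟩
  · have := (le_div_iff₀ hM).1 (Nat.floor_le (div_nonneg ht hM.le))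
    linarith
  · have := (div_lt_iff₀ hM).1 (Nat.lt_floor_add_one (t / M))
    linarith

theorem commute_of_local_add
    (hadd : ∀ s t, 0 ≤ s → 0 ≤ t → s + t ≤ M → S (s + t) = S s * S t)
    {s t : ℝ} (hs : 0 ≤ s) (hsM : s ≤ M) (ht : 0 ≤ t) (htM : t ≤ M) : Commute (S s) (S t) := by
  -- `s + t` may exceed `M`, but the sum of the halves does not.
  have h2 : ∀ r, 0 ≤ r → r ≤ M → S r = S (r / 2) * S (r / 2) := fun r h0 h1 => by
    rw [← hadd _ _ (by linarith) (by linarith) (by linarith)]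
    congr 1
    ring
  have hc : Commute (S (s / 2)) (S (t / 2)) := by
    rw [Commute, SemiconjBy, ← hadd _ _ (by linarith) (by linarith) (by linarith),
      ← hadd _ _ (by linarith) (by linarith) (by linarith), add_comm]
  rw [h2 s hs hsM, h2 t ht htM]
  exact (hc.mul_right hc).mul_left (hc.mul_right hc)

theorem extendOp_add (hM : 0 < M)
    (hadd : ∀ s t, 0 ≤ s → 0 ≤ t → s + t ≤ M → S (s + t) = S s * S t)
    {s t : ℝ} (hs : 0 ≤ s) (ht : 0 ≤ t) :
    extendOp S M (s + t) = extendOp S M s * extendOp S M t := by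
  obtain ⟨n, r, hr0, hrM, hsr⟩ := exists_eq_nat_mul_add hM hs
  obtain ⟨m, q, hq0, hqM, htq⟩ := exists_eq_nat_mul_add hM ht
  rw [extendOp_of_eq hM hr0 hrM hsr, extendOp_of_eq hM hq0 hqM htq]
  have hc : Commute (S r) (S M ^ m) :=
    (commute_of_local_add hadd hr0 hrM.le hM.le le_rfl).pow_right m
  have e : S M ^ n * S r * (S M ^ m * S q) = S M ^ (n + m) * (S r * S q) := by
    rw [mul_assoc, ← mul_assoc (S r), hc.eq, mul_assoc, ← mul_assoc, pow_add]
  rw [e]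
  rcases lt_or_ge (r + q) M with h | h
  · rw [extendOp_of_eq hM (n := n + m) (r := r + q) (by linarith) h
      (by push_cast; rw [hsr, htq]; ring), hadd r q hr0 hq0 h.le]
  -- Over the remainder, complete one more period: `r = (r + q - M) + (M - q)`.
  · rw [extendOp_of_eq hM (n := n + m + 1) (r := r + q - M) (by linarith) (by linarith)
      (by push_cast; rw [hsr, htq]; ring), pow_succ, mul_assoc]
    congr 1
    have h1 := hadd (r + q - M) (M - q) (by linarith) (by linarith) (by linarith)
    have h2 := hadd (M - q) q (by linarith) (by linarith) (by linarith)
    rw [show r + q - M + (M - q) = r by ring] at h1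
    rw [show M - q + q = M by ring] at h2
    rw [h1, mul_assoc, ← h2,
      (commute_of_local_add hadd (by linarith) (by linarith) hM.le le_rfl).eq]

end Extend

variable {X : Type*} [NormedAddCommGroup X] [NormedSpace ℝ X]

theorem eventually_nnreal_lt {M : ℝ} (hM : 0 < M) : ∀ᶠ t : ℝ≥0 in 𝓝 0, (t : ℝ) < M :=
  (NNReal.continuous_coe.tendsto 0).eventually (gt_mem_nhds (by simpa using hM))

/-- The `C₀`-semigroup that extends a strongly continuous family of operators satisfying the
semigroup law up to time `M`. -/
noncomputable def C0Semigroup.ofLocal (S : ℝ → X →L[ℝ] X) (M : ℝ) (hM : 0 < M) (h0 : S 0 = 1)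
    (hadd : ∀ s t, 0 ≤ s → 0 ≤ t → s + t ≤ M → S (s + t) = S s * S t)
    (hcont : ∀ x, Tendsto (fun t : ℝ≥0 => S t x) (𝓝 0) (𝓝 x)) : C0Semigroup X where
  op t := extendOp S M t
  op_zero := by
    rw [extendOp_of_eq hM (n := 0) (r := 0) le_rfl hM (by simp), h0]
    rfl
  op_add s t := by
    rw [NNReal.coe_add]
    exact extendOp_add hM hadd s.2 t.2
  strong_continuity x := by
    refine (hcont x).congr' ?_
    filter_upwards [eventually_nnreal_lt hM] with t ht
    rw [extendOp_of_eq hM (n := 0) t.2 ht (by simp)]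
    simp

theorem C0Semigroup.ofLocal_op_of_lt {S : ℝ → X →L[ℝ] X} {M : ℝ} {hM : 0 < M} {h0 : S 0 = 1}
    {hadd : ∀ s t, 0 ≤ s → 0 ≤ t → s + t ≤ M → S (s + t) = S s * S t}
    {hcont : ∀ x, Tendsto (fun t : ℝ≥0 => S t x) (𝓝 0) (𝓝 x)} {t : ℝ≥0} (ht : (t : ℝ) < M) :
    (C0Semigroup.ofLocal S M hM h0 hadd hcont).op t = S t := by
  change extendOp S M t = _
  rw [extendOp_of_eq hM (n := 0) t.2 ht (by simp)]
  simp

theorem C0Semigroup.ofLocal_op_self {S : ℝ → X →L[ℝ] X} {M : ℝ} {hM : 0 < M} {h0 : S 0 = 1}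
    {hadd : ∀ s t, 0 ≤ s → 0 ≤ t → s + t ≤ M → S (s + t) = S s * S t}
    {hcont : ∀ x, Tendsto (fun t : ℝ≥0 => S t x) (𝓝 0) (𝓝 x)} {t : ℝ≥0} (ht : (t : ℝ) = M) :
    (C0Semigroup.ofLocal S M hM h0 hadd hcont).op t = S M := by
  change extendOp S M t = _
  rw [ht, extendOp_of_eq hM (n := 1) (r := 0) le_rfl hM (by simp), h0]
  simp

/-! ### A generator determines its semigroup -/

theorem tendsto_toNNReal_sub (s : ℝ) :
    Tendsto (fun r : ℝ => (r - s).toNNReal) (𝓝[>] s) (𝓝[>] 0) := by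
  refine tendsto_nhdsWithin_iff.2 ⟨?_, ?_⟩
  · have : Continuous fun r : ℝ => (r - s).toNNReal := by fun_prop
    simpa using (this.tendsto s).mono_left nhdsWithin_le_nhds
  · filter_upwards [self_mem_nhdsWithin] with r hr
    simpa using hr

theorem tendsto_coe_nhdsGT : Tendsto (fun h : ℝ≥0 => (h : ℝ)) (𝓝[>] 0) (𝓝[>] 0) := by
  refine tendsto_nhdsWithin_iff.2 ⟨?_, ?_⟩
  · exact (NNReal.continuous_coe.tendsto 0).mono_left nhdsWithin_le_nhds
  · filter_upwards [self_mem_nhdsWithin] with r hr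
    simpa using hr

namespace C0Semigroup

variable (T : C0Semigroup X)

theorem op_nsmul (n : ℕ) (t : ℝ≥0) : T.op (n • t) = T.op t ^ n := by
  induction n with
  | zero => rw [zero_nsmul, T.op_zero, pow_zero]; rfl
  | succ n ih => rw [succ_nsmul, T.op_add, ih, pow_succ]; rfl

theorem op_add_apply (s t : ℝ≥0) (x : X) : T.op (s + t) x = T.op s (T.op t x) := by
  rw [T.op_add]; rfl

theorem exists_bound_near_zero [CompleteSpace X] :
    ∃ δ : ℝ≥0, 0 < δ ∧ ∃ C : ℝ, ∀ t ≤ δ, ‖T.op t‖ ≤ C := by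
  by_contra! h
  have hpos : ∀ n : ℕ, (0 : ℝ≥0) < 1 / ((n : ℝ≥0) + 1) := fun n => by positivity
  choose t ht hb using fun n : ℕ => h _ (hpos n) (n : ℝ)
  have ht0 : Tendsto t atTop (𝓝 0) :=
    tendsto_of_tendsto_of_tendsto_of_le_of_le tendsto_const_nhds
      tendsto_one_div_add_atTop_nhds_zero_nat (fun _ => zero_le) ht
  obtain ⟨C, hC⟩ := banach_steinhaus (g := fun n => T.op (t n)) fun x => by
    obtain ⟨C, hC⟩ := ((T.strong_continuity x).comp ht0).norm.bddAbove_range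
    exact ⟨C, fun n => hC ⟨n, rfl⟩⟩
  obtain ⟨n, hn⟩ := exists_nat_gt C
  linarith [hC n, hb n]

theorem exists_bound [CompleteSpace X] (b : ℝ≥0) :
    ∃ C : ℝ, 0 ≤ C ∧ ∀ t ≤ b, ‖T.op t‖ ≤ C := by
  obtain ⟨δ, hδ, C, hC⟩ := T.exists_bound_near_zero
  obtain ⟨n, hn⟩ := exists_nat_gt (b / δ)
  have hn0 : (0 : ℝ≥0) < n := lt_of_le_of_lt (zero_le) hn
  have hC0 : 0 ≤ C := (norm_nonneg _).trans (hC 0 zero_le)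
  refine ⟨C ^ n, by positivity, fun t ht => ?_⟩
  have e : t = n • (t / n) := by
    rw [nsmul_eq_mul, mul_div_cancel₀ _ hn0.ne']
  have hle : t / n ≤ δ := by
    rw [div_le_iff₀ hn0, mul_comm]
    exact ht.trans ((div_lt_iff₀ hδ).1 hn).le
  rw [e, T.op_nsmul]
  have hn1 : 0 < n := by exact_mod_cast hn0
  exact (norm_pow_le' _ hn1).trans (pow_le_pow_left₀ (norm_nonneg _) (hC _ hle) n)

theorem continuous_op_apply [CompleteSpace X] (x : X) : Continuous fun t => T.op t x := by
  rw [continuous_iff_continuousAt]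
  intro s
  obtain ⟨C, hC0, hC⟩ := T.exists_bound (s + 1)
  rw [ContinuousAt, tendsto_iff_norm_sub_tendsto_zero]
  have hd : Tendsto (fun t : ℝ≥0 => max t s - min t s) (𝓝 s) (𝓝 0) := by
    have : Continuous fun t : ℝ≥0 => max t s - min t s := by fun_prop
    simpa using this.tendsto s
  have hlim : Tendsto (fun t : ℝ≥0 => C * ‖T.op (max t s - min t s) x - x‖) (𝓝 s) (𝓝 0) := by
    have := (((T.strong_continuity x).comp hd).sub_const x).norm.const_mul C
    simpa using this
  refine tendsto_of_tendsto_of_tendsto_of_le_of_le' tendsto_const_nhds hlim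
    (Eventually.of_forall fun _ => norm_nonneg _) ?_
  filter_upwards [gt_mem_nhds (show s < s + 1 by simp)] with t ht
  have key : ∀ a b : ℝ≥0, a ≤ b → a ≤ s + 1 →
      ‖T.op b x - T.op a x‖ ≤ C * ‖T.op (b - a) x - x‖ := fun a b hab ha => by
    have e : T.op b x - T.op a x = T.op a (T.op (b - a) x - x) := by
      rw [map_sub, ← T.op_add_apply, add_tsub_cancel_of_le hab]
    rw [e]
    exact (T.op a).le_of_opNorm_le (hC a ha) _
  rcases le_total t s with h | h
  · rw [max_eq_right h, min_eq_left h, norm_sub_rev]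
    exact key t s h ht.le
  · rw [max_eq_left h, min_eq_right h]
    exact key s t h (by simp)

theorem continuous_op_apply₂ [CompleteSpace X] {r : ℝ → ℝ≥0} {y : ℝ → X} (hr : Continuous r)
    (hy : Continuous y) : Continuous fun s => T.op (r s) (y s) := by
  rw [continuous_iff_continuousAt]
  intro s
  obtain ⟨C, hC0, hC⟩ := T.exists_bound (r s + 1)
  have h1 : Tendsto (fun u => T.op (r u) (y u - y s)) (𝓝 s) (𝓝 0) := by
    have hlim : Tendsto (fun u => C * ‖y u - y s‖) (𝓝 s) (𝓝 0) := by
      simpa using ((hy.tendsto s).sub_const (y s)).norm.const_mul C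
    refine squeeze_zero_norm' ?_ hlim
    filter_upwards [hr.continuousAt.eventually (gt_mem_nhds (show r s < r s + 1 by simp))] with u hu
    exact (T.op (r u)).le_of_opNorm_le (hC _ hu.le) _
  have h2 : Tendsto (fun u => T.op (r u) (y s)) (𝓝 s) (𝓝 (T.op (r s) (y s))) :=
    ((T.continuous_op_apply (y s)).comp hr).tendsto s
  have := h1.add h2
  rw [zero_add] at this
  refine this.congr fun u => ?_
  rw [map_sub, sub_add_cancel]

variable {T}

theorem op_mem_domain {A : X →ₗ.[ℝ] X} (hT : T.IsGeneratedBy A) (s : ℝ≥0) {x : X}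
    (hx : x ∈ A.domain) : T.op s x ∈ A.domain := by
  have h := (hT x _).1 ⟨hx, rfl⟩
  have := ((T.op s).continuous.tendsto _).comp h
  refine ((hT _ _).2 (this.congr fun h => ?_)).1
  rw [Function.comp_apply, map_smul, map_sub, ← T.op_add_apply, ← T.op_add_apply, add_comm]

/-- Time averages of orbits lie in the domain of the generator, so the domain is dense. -/
theorem dense_domain [CompleteSpace X] {A : X →ₗ.[ℝ] X} (hT : T.IsGeneratedBy A) :
    Dense (A.domain : Set X) := by
  intro x
  have hF : Continuous fun r : ℝ => T.op r.toNNReal x :=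
    (T.continuous_op_apply x).comp continuous_real_toNNReal
  set F : ℝ → X := fun r => T.op r.toNNReal x with hFdef
  have hi : ∀ a b : ℝ, IntervalIntegrable F volume a b := fun a b => hF.intervalIntegrable a b
  have hder : ∀ b : ℝ, Tendsto (fun k : ℝ => k⁻¹ • ∫ r in b..b + k, F r) (𝓝[>] 0) (𝓝 (F b)) := by
    intro b
    have h : HasDerivAt (fun u => ∫ r in b..u, F r) (F b) b :=
      intervalIntegral.integral_hasDerivAt_right (hi b b)
        (hF.stronglyMeasurableAtFilter _ _) hF.continuousAt
    have := h.tendsto_slope_zero_right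
    simpa using this
  have hmem : ∀ h : ℝ, 0 ≤ h → (∫ r in 0..h, F r) ∈ A.domain := by
    intro h hh
    refine ((hT _ (F h - F 0)).2 ?_).1
    have := ((hder h).sub (hder 0)).comp tendsto_coe_nhdsGT
    refine this.congr fun k => ?_
    have e : T.op k (∫ r in 0..h, F r) = ∫ r in (k : ℝ)..h + k, F r := by
      rw [← ContinuousLinearMap.intervalIntegral_comp_comm _ (hi 0 h)]
      have : (∫ r in (0 : ℝ)..h, T.op k (F r)) = ∫ r in (0 : ℝ)..h, F (r + k) := by
        refine intervalIntegral.integral_congr fun r hr => ?_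
        rw [uIcc_of_le hh] at hr
        simp only [hFdef]
        rw [Real.toNNReal_add hr.1 k.coe_nonneg, Real.toNNReal_coe, add_comm, T.op_add_apply]
      rw [this, intervalIntegral.integral_comp_add_right (fun r => F r) (k : ℝ), zero_add]
    simp only [Function.comp_apply, e, ← smul_sub, zero_add]
    congr 1
    rw [← intervalIntegral.integral_add_adjacent_intervals (hi k h) (hi h (h + k)),
      ← intervalIntegral.integral_add_adjacent_intervals (hi 0 k) (hi k h)]
    abel
  have hlim : Tendsto (fun k : ℝ => k⁻¹ • ∫ r in 0..k, F r) (𝓝[>] 0) (𝓝 x) := by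
    have := hder 0
    simpa [hFdef, T.op_zero] using this
  refine mem_closure_of_tendsto hlim ?_
  filter_upwards [self_mem_nhdsWithin] with k hk
  exact A.domain.smul_mem _ (hmem k (le_of_lt hk))

/-- Two semigroups with the same generator agree: for `x` in the domain, the curve
`s ↦ T'(t - s) T(s) x` has vanishing right derivative on `[0, t)`. -/
theorem eq_of_isGeneratedBy [CompleteSpace X] {A : X →ₗ.[ℝ] X} {T T' : C0Semigroup X}
    (hT : T.IsGeneratedBy A) (hT' : T'.IsGeneratedBy A) : T' = T := by
  have key : ∀ (t : ℝ≥0) (x : X), x ∈ A.domain → T'.op t x = T.op t x := by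
    intro t x hx
    set u : ℝ → X := fun s => T'.op ((t : ℝ) - s).toNNReal (T.op s.toNNReal x) with hu
    have hcont : Continuous u := T'.continuous_op_apply₂ (by fun_prop)
      ((T.continuous_op_apply x).comp continuous_real_toNNReal)
    obtain ⟨C, hC0, hC⟩ := T'.exists_bound t
    have hder : ∀ s ∈ Ico (0 : ℝ) t, HasDerivWithinAt u 0 (Ici s) s := by
      intro s hs
      rw [hasDerivWithinAt_iff_tendsto_slope, Ici_sdiff_left]
      set y := T.op s.toNNReal x with hy
      have hyA : y ∈ A.domain := op_mem_domain hT _ hx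
      have h1 := (hT y _).1 ⟨hyA, rfl⟩
      have h2 := (hT' y _).1 ⟨hyA, rfl⟩
      have h3 := ((h1.sub h2).comp (tendsto_toNNReal_sub s)).norm.const_mul C
      rw [sub_self, norm_zero, mul_zero] at h3
      refine squeeze_zero_norm' ?_ h3
      filter_upwards [Ioc_mem_nhdsGT hs.2] with r hr
      have e1 : T.op r.toNNReal x = T.op (r - s).toNNReal y := by
        rw [hy, ← T.op_add_apply, ← Real.toNNReal_add (by linarith [hr.1]) hs.1, sub_add_cancel]
      have e2 : u s = T'.op ((t : ℝ) - r).toNNReal (T'.op (r - s).toNNReal y) := by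
        rw [← T'.op_add_apply, ← Real.toNNReal_add (by linarith [hr.2]) (by linarith [hr.1])]
        simp [hu, hy]
      have hc : ((r - s).toNNReal : ℝ) = r - s := Real.coe_toNNReal _ (by linarith [hr.1])
      simp only [Function.comp_apply, ← smul_sub, sub_sub_sub_cancel_right, hc]
      rw [slope_def_module, e2]
      simp only [hu, e1]
      rw [← map_sub, ← map_smul]
      refine (T'.op _).le_of_opNorm_le (hC _ ?_) _
      rw [Real.toNNReal_le_iff_le_coe]
      linarith [hr.1, hs.1]
    have := constant_of_has_deriv_right_zero hcont.continuousOn hder t ⟨t.2, le_rfl⟩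
    simpa [hu, T.op_zero, T'.op_zero] using this.symm
  refine C0Semigroup.ext (funext fun t => ?_)
  exact ContinuousLinearMap.coeFn_injective ((T'.op t).continuous.ext_on (dense_domain hT)
    (T.op t).continuous fun x hx => key t x hx)

end C0Semigroup

/-! ### Primitives of integrable functions and weak derivatives -/

theorem primitive_absolutelyContinuous {f : ℝ → ℝ} {a b : ℝ} (hf : IntervalIntegrable f volume a b)
    (c : ℝ) : AbsolutelyContinuousOnInterval (fun x => c + ∫ t in a..x, f t) a b := by
  have h1 : AbsolutelyContinuousOnInterval (fun _ : ℝ => c) a b :=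
    contDiffOn_const.absolutelyContinuousOnInterval
  exact h1.add (hf.absolutelyContinuousOnInterval_intervalIntegral (by simp))

/-- Integration by parts of a `C¹` function against a primitive of an integrable function. -/
theorem integral_deriv_mul_primitive {f u : ℝ → ℝ} {a b : ℝ} (c : ℝ)
    (hf : IntervalIntegrable f volume a b) (hu : ContDiff ℝ 1 u) :
    ∫ x in a..b, (c + ∫ t in a..x, f t) * deriv u x =
      (c + ∫ t in a..b, f t) * u b - c * u a - ∫ x in a..b, f x * u x := by
  have hg := primitive_absolutelyContinuous hf c
  have hu' : AbsolutelyContinuousOnInterval u a b :=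
    hu.contDiffOn.absolutelyContinuousOnInterval
  rw [hg.integral_mul_deriv_eq_deriv_mul hu']
  have e : ∫ x in a..b, deriv (fun x => c + ∫ t in a..x, f t) x * u x = ∫ x in a..b, f x * u x := by
    refine intervalIntegral.integral_congr_ae ?_
    filter_upwards [hf.ae_hasDerivAt_integral] with x hx hxm
    rw [((hx (uIoc_subset_uIcc hxm) a (by simp)).const_add c).deriv]
  rw [e]
  simp

theorem intervalIntegrable_of_integrableOn_Ioo {L a b : ℝ} {v : ℝ → ℝ}
    (hv : IntegrableOn v (Ioo 0 L)) (ha : a ∈ Icc 0 L) (hb : b ∈ Icc 0 L) :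
    IntervalIntegrable v volume a b := by
  rw [intervalIntegrable_iff]
  exact ((integrableOn_Icc_iff_integrableOn_Ioo).2 hv).mono_set
    (uIoc_subset_uIcc.trans (uIcc_subset_Icc ha hb))

theorem continuousOn_primitive_Icc {L : ℝ} (hL : 0 ≤ L) {v : ℝ → ℝ}
    (hv : IntegrableOn v (Ioo 0 L)) (c : ℝ) :
    ContinuousOn (fun x => c + ∫ t in (0 : ℝ)..x, v t) (Icc 0 L) := by
  have := (primitive_absolutelyContinuous (intervalIntegrable_of_integrableOn_Ioo hv
    (left_mem_Icc.2 hL) (right_mem_Icc.2 hL)) c).continuousOn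
  rwa [uIcc_of_le hL] at this

theorem setIntegral_Ioo_eq_intervalIntegral {L : ℝ} (hL : 0 ≤ L) (f : ℝ → ℝ) :
    ∫ x in Ioo 0 L, f x = ∫ x in (0 : ℝ)..L, f x := by
  rw [intervalIntegral.integral_of_le hL, integral_Ioc_eq_integral_Ioo]

theorem integrableOn_Ioo_primitive {L : ℝ} (hL : 0 ≤ L) {v : ℝ → ℝ}
    (hv : IntegrableOn v (Ioo 0 L)) (c : ℝ) :
    IntegrableOn (fun x => c + ∫ t in (0 : ℝ)..x, v t) (Ioo 0 L) :=
  ((continuousOn_primitive_Icc hL hv c).integrableOn_Icc).mono_set Ioo_subset_Icc_self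

theorem hasWeakDeriv_primitive {L : ℝ} (hL : 0 ≤ L) {v : ℝ → ℝ}
    (hv : IntegrableOn v (Ioo 0 L)) (c : ℝ) :
    HasWeakDeriv L (fun x => c + ∫ t in (0 : ℝ)..x, v t) v := by
  intro φ hφ _ hs
  have hz : ∀ x, x ∉ Ioo 0 L → φ x = 0 := fun x hx =>
    image_eq_zero_of_notMem_tsupport fun h => hx (hs h)
  rw [setIntegral_Ioo_eq_intervalIntegral hL, setIntegral_Ioo_eq_intervalIntegral hL,
    integral_deriv_mul_primitive c (intervalIntegrable_of_integrableOn_Ioo hv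
      (left_mem_Icc.2 hL) (right_mem_Icc.2 hL)) (hφ.of_le (by simp)),
    hz 0 (by simp), hz L (by simp)]
  ring

theorem IsCompact.subset_Icc_of_subset_Ioo {L : ℝ} (hL : 0 < L) {K : Set ℝ} (hK : IsCompact K)
    (hs : K ⊆ Ioo 0 L) : ∃ a b, 0 < a ∧ b < L ∧ K ⊆ Icc a b := by
  rcases K.eq_empty_or_nonempty with rfl | hne
  · exact ⟨L, 0, hL, hL, empty_subset _⟩
  · obtain ⟨a, ha⟩ := hK.exists_isLeast hne
    obtain ⟨b, hb⟩ := hK.exists_isGreatest hne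
    exact ⟨a, b, (hs ha.1).1, (hs hb.1).2, fun _ hx => ⟨ha.2 hx, hb.2 hx⟩⟩

/-- A test function of integral zero is the derivative of a test function. -/
theorem exists_test_primitive {L : ℝ} (hL : 0 < L) {χ : ℝ → ℝ} (hχ : ContDiff ℝ ∞ χ)
    (hc : HasCompactSupport χ) (hs : tsupport χ ⊆ Ioo 0 L) (h0 : ∫ x, χ x = 0) :
    ∃ Φ : ℝ → ℝ, ContDiff ℝ ∞ Φ ∧ HasCompactSupport Φ ∧ tsupport Φ ⊆ Ioo 0 L ∧ deriv Φ = χ := by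
  obtain ⟨a, b, ha, hb, hK⟩ := IsCompact.subset_Icc_of_subset_Ioo hL hc hs
  have hder : ∀ x, HasDerivAt (fun x => ∫ t in (0 : ℝ)..x, χ t) (χ x) x := fun x =>
    intervalIntegral.integral_hasDerivAt_right (hχ.continuous.intervalIntegrable _ _)
      (hχ.continuous.stronglyMeasurableAtFilter _ _) hχ.continuous.continuousAt
  have hd : deriv (fun x => ∫ t in (0 : ℝ)..x, χ t) = χ := funext fun x => (hder x).deriv
  have hz : ∀ x, x ∉ Icc a b → χ x = 0 := fun x hx =>
    image_eq_zero_of_notMem_tsupport fun h => hx (hK h)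
  have hsub : tsupport (fun x => ∫ t in (0 : ℝ)..x, χ t) ⊆ Icc a b := by
    refine closure_minimal (fun x hx => ?_) isClosed_Icc
    by_contra hxn
    refine hx ?_
    rcases lt_or_ge x a with h | h
    · refine intervalIntegral.integral_zero_ae (Eventually.of_forall fun t ht => hz t fun h' => ?_)
      have := (uIoc_subset_uIcc ht).2
      have h3 : max 0 x < a := max_lt ha h
      linarith [h'.1]
    · have hbx : b < x := by
        by_contra h'
        exact hxn ⟨h, not_lt.1 h'⟩
      change ∫ t in (0 : ℝ)..x, χ t = 0
      rw [intervalIntegral.integral_eq_integral_of_support_subset, h0]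
      intro t ht
      have : t ∈ Icc a b := by_contra fun h' => ht (hz t h')
      exact ⟨ha.trans_le this.1, this.2.trans hbx.le⟩
  refine ⟨_, ?_, HasCompactSupport.of_support_subset_isCompact isCompact_Icc
    (subset_closure.trans hsub), hsub.trans (Icc_subset_Ioo ha hb), hd⟩
  rw [contDiff_infty_iff_deriv, hd]
  exact ⟨fun x => (hder x).differentiableAt, hχ⟩

theorem setIntegral_Ioo_test {L : ℝ} {φ : ℝ → ℝ} (hs : tsupport φ ⊆ Ioo 0 L) :
    ∫ x in Ioo 0 L, φ x = ∫ x, φ x :=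
  setIntegral_eq_integral_of_forall_compl_eq_zero fun _ hx =>
    image_eq_zero_of_notMem_tsupport fun h => hx (hs h)

/-- The du Bois-Reymond lemma: a function with vanishing weak derivative is constant. -/
theorem HasWeakDeriv.ae_eq_const {L : ℝ} (hL : 0 < L) {D : ℝ → ℝ}
    (hD : IntegrableOn D (Ioo 0 L)) (h : HasWeakDeriv L D (fun _ => 0)) :
    ∃ c, D =ᵐ[volume.restrict (Ioo 0 L)] fun _ => c := by
  let B : ContDiffBump (L / 2) := ⟨L / 8, L / 4, by linarith, by linarith⟩
  set ψ : ℝ → ℝ := B.normed volume with hψ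
  have hψs : tsupport ψ ⊆ Ioo 0 L := by
    rw [hψ, B.tsupport_normed_eq, Real.closedBall_eq_Icc]
    exact Icc_subset_Ioo (by change 0 < L / 2 - L / 4; linarith)
      (by change L / 2 + L / 4 < L; linarith)
  have hψd : ContDiff ℝ ∞ ψ := B.contDiff_normed
  have hψc : HasCompactSupport ψ := B.hasCompactSupport_normed
  have hψ1 : ∫ x, ψ x = 1 := B.integral_normed
  set c := ∫ x in Ioo 0 L, D x * ψ x with hcdef
  have hconst : IntegrableOn (fun _ : ℝ => c) (Ioo 0 L) := by simp
  -- Both `D` and the constant `c` are weak derivatives of `x ↦ c x`: subtract from a test function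
  -- a multiple of `ψ` to make its integral vanish, so that it becomes the derivative of another.
  refine ⟨c, HasWeakDeriv.unique (f := fun x => 0 + ∫ t in (0 : ℝ)..x, c) hD hconst ?_
    (hasWeakDeriv_primitive hL.le hconst 0)⟩
  intro φ hφ hc hs
  rw [hasWeakDeriv_primitive hL.le hconst 0 φ hφ hc hs, neg_inj]
  have hχs : tsupport (fun x => φ x - (∫ y, φ y) * ψ x) ⊆ Ioo 0 L := by
    refine (tsupport_sub φ fun x => (∫ y, φ y) * ψ x).trans (union_subset hs ?_)
    exact (tsupport_mul_subset_right (f := fun _ : ℝ => ∫ y, φ y)).trans hψs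
  have hi : Integrable φ := hφ.continuous.integrable_of_hasCompactSupport hc
  have hiψ : Integrable ψ := hψd.continuous.integrable_of_hasCompactSupport hψc
  obtain ⟨Φ, h1, h2, h3, h4⟩ := exists_test_primitive hL
    (χ := fun x => φ x - (∫ y, φ y) * ψ x) (hφ.sub (contDiff_const.mul hψd))
    (hc.sub hψc.mul_left) hχs (by
      rw [integral_sub hi (hiψ.const_mul _), integral_const_mul, hψ1]; ring)
  have h5 := h Φ h1 h2 h3
  simp only [h4, zero_mul, integral_zero, neg_zero, mul_sub] at h5
  rw [integral_sub (integrableOn_mul_test hD hφ.continuous hc)] at h5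
  · have e : ∫ x in Ioo 0 L, D x * ((∫ y, φ y) * ψ x) = (∫ y, φ y) * c := by
      rw [hcdef, ← integral_const_mul]
      congr 1
      ext x
      ring
    rw [e] at h5
    rw [integral_const_mul, setIntegral_Ioo_test hs]
    linarith
  · exact integrableOn_mul_test hD (continuous_const.mul hψd.continuous) hψc.mul_left

theorem HasWeakDeriv.ae_eq_primitive {L : ℝ} (hL : 0 < L) {f v : ℝ → ℝ}
    (hf : IntegrableOn f (Ioo 0 L)) (hv : IntegrableOn v (Ioo 0 L)) (h : HasWeakDeriv L f v) :
    ∃ c, f =ᵐ[volume.restrict (Ioo 0 L)] fun x => c + ∫ t in (0 : ℝ)..x, v t := by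
  have hp := integrableOn_Ioo_primitive hL.le hv 0
  have h2 := (hasWeakDeriv_primitive hL.le hv 0).const_mul (-1)
  have h3 := h.add hf (hp.const_mul (-1)) hv (hv.const_mul (-1)) h2
  rw [show (fun x => v x + -1 * v x) = fun _ => 0 by ext; ring] at h3
  obtain ⟨c, hc⟩ := h3.ae_eq_const hL (hf.add (hp.const_mul (-1)))
  refine ⟨c, ?_⟩
  filter_upwards [hc] with x hx
  rw [← hx]
  simp

/-- Functions that are continuous on `[0, L]` and agree almost everywhere on `(0, L)` agree on
`[0, L]`. -/
theorem ContinuousOn.eqOn_Icc_of_ae_eq {L : ℝ} (hL : 0 < L) {f g : ℝ → ℝ}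
    (hf : ContinuousOn f (Icc 0 L)) (hg : ContinuousOn g (Icc 0 L))
    (h : f =ᵐ[volume.restrict (Ioo 0 L)] g) : EqOn f g (Icc 0 L) := by
  have h1 : EqOn f g (Ioo 0 L) := Measure.eqOn_open_of_ae_eq h isOpen_Ioo
    (hf.mono Ioo_subset_Icc_self) (hg.mono Ioo_subset_Icc_self)
  exact h1.of_subset_closure hf hg Ioo_subset_Icc_self (by rw [closure_Ioo hL.ne])

/-! ### Translations in `L¹(ℝ)` -/

theorem tendsto_lintegral_translate {f : ℝ → ℝ} (hf : Integrable f) :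
    Tendsto (fun h : ℝ => ∫⁻ x, ‖f (h + x) - f x‖ₑ) (𝓝 0) (𝓝 0) := by
  have : Fact ((1 : ENNReal) ≠ ⊤) := ⟨ENNReal.one_ne_top⟩
  have hm : MemLp f 1 volume := memLp_one_iff_integrable.2 hf
  have hc : Continuous fun h : ℝ => DomAddAct.mk h +ᵥ hm.toLp f := by
    have : Continuous fun h : ℝ => DomAddAct.mk h := DomAddAct.continuous_mk
    exact this.vadd continuous_const
  have h1 : Tendsto (fun h : ℝ => edist (DomAddAct.mk h +ᵥ hm.toLp f) (hm.toLp f)) (𝓝 0) (𝓝 0) := by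
    rw [← tendsto_iff_edist_tendsto_0]
    simpa using hc.tendsto 0
  refine h1.congr fun h => ?_
  rw [DomAddAct.mk_vadd_toLp, Lp.edist_toLp_toLp, eLpNorm_one_eq_lintegral_enorm]
  rfl

/-- Difference quotients of a primitive of `f ∈ L¹(ℝ)` converge to `f` in `L¹(ℝ)`. -/
theorem tendsto_lintegral_diffQuot {f : ℝ → ℝ} (hf : Integrable f) :
    Tendsto (fun h : ℝ => ∫⁻ x, ‖h⁻¹ * (∫ r in x..x + h, f r) - f x‖ₑ) (𝓝[>] 0) (𝓝 0) := by
  rw [ENNReal.tendsto_nhds_zero]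
  intro ε hε
  have h1 := (ENNReal.tendsto_nhds_zero.1 (tendsto_lintegral_translate hf)) ε hε
  obtain ⟨δ, hδ, hδ'⟩ := Metric.eventually_nhds_iff.1 h1
  filter_upwards [Ioo_mem_nhdsGT hδ] with h hh
  have hi : ∀ a b : ℝ, IntervalIntegrable f volume a b := fun a b => hf.intervalIntegrable
  -- The error is an average over `r ∈ (0, h]` of translation errors, by Fubini.
  have hpt : ∀ x, ‖h⁻¹ * (∫ r in x..x + h, f r) - f x‖ₑ ≤
      ENNReal.ofReal h⁻¹ * ∫⁻ r in Ioc 0 h, ‖f (r + x) - f x‖ₑ := by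
    intro x
    have e : h⁻¹ * (∫ r in x..x + h, f r) - f x = h⁻¹ * ∫ r in Ioc 0 h, (f (r + x) - f x) := by
      rw [← intervalIntegral.integral_of_le hh.1.le, intervalIntegral.integral_sub
        (by simpa using (hi (0 + x) (h + x)).comp_add_right x) (by simp),
        intervalIntegral.integral_comp_add_right, zero_add, add_comm h x]
      simp only [intervalIntegral.integral_const, sub_zero, smul_eq_mul]
      have := hh.1.ne'
      field_simp
    rw [e, enorm_mul, Real.enorm_of_nonneg (inv_nonneg.2 hh.1.le)]
    gcongr
    exact enorm_integral_le_lintegral_enorm _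
  have hmeas : AEMeasurable (Function.uncurry fun x r : ℝ => ‖f (r + x) - f x‖ₑ)
      (volume.prod (volume.restrict (Ioc 0 h))) := by
    have hac : (volume : Measure ℝ).prod (volume.restrict (Ioc 0 h)) ≪ volume.prod volume :=
      Measure.AbsolutelyContinuous.rfl.prod Measure.restrict_le_self.absolutelyContinuous
    have m1 : AEStronglyMeasurable (fun z : ℝ × ℝ => f (z.2 + z.1)) (volume.prod volume) := by
      have := (hf.aestronglyMeasurable.comp_snd (μ := (volume : Measure ℝ))).comp_measurePreserving
        (measurePreserving_prod_add (volume : Measure ℝ) volume)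
      refine this.congr (Eventually.of_forall fun z => ?_)
      simp [add_comm]
    have m2 : AEStronglyMeasurable (fun z : ℝ × ℝ => f z.1) (volume.prod volume) :=
      hf.aestronglyMeasurable.comp_fst
    exact ((m1.sub m2).mono_ac hac).enorm
  calc ∫⁻ x, ‖h⁻¹ * (∫ r in x..x + h, f r) - f x‖ₑ
      ≤ ∫⁻ x, ENNReal.ofReal h⁻¹ * ∫⁻ r in Ioc 0 h, ‖f (r + x) - f x‖ₑ := lintegral_mono hpt
    _ = ENNReal.ofReal h⁻¹ * ∫⁻ r in Ioc 0 h, ∫⁻ x, ‖f (r + x) - f x‖ₑ := by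
        rw [lintegral_const_mul' _ _ ENNReal.ofReal_ne_top, lintegral_lintegral_swap hmeas]
    _ ≤ ENNReal.ofReal h⁻¹ * ∫⁻ r in Ioc 0 h, ε := by
        gcongr 1
        refine setLIntegral_mono measurable_const fun r hr => hδ' ?_
        rw [Real.dist_0_eq_abs, abs_of_pos hr.1]
        exact hr.2.trans_lt hh.2
    _ = ε := by
        rw [setLIntegral_const, Real.volume_Ioc, sub_zero, mul_comm ε, ← mul_assoc,
          ← ENNReal.ofReal_mul (inv_nonneg.2 hh.1.le), inv_mul_cancel₀ hh.1.ne']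
        simp

/-! ### The delay equation in the travel-time coordinate -/

/-- The flux through the inlet at the past times `s ∈ (-M, 0)` that a profile `q` on `(0, M)`,
transported at unit speed, records: `q(-s)`; zero at all other times. -/
noncomputable def pastFlux (M : ℝ) (q : ℝ → ℝ) (s : ℝ) : ℝ := (Ioo 0 M).indicator q (-s)

/-- The solution `p` of `p'(t) = pastFlux (t - M) - κ p(t)`, `p(0) = p₀`, by variation of
constants. Up to time `M` this is the first component of the transported state. -/
noncomputable def atomMass (κ M : ℝ) (P : StateSpace M) (t : ℝ) : ℝ :=
  Real.exp (-κ * t) * (P.fst + ∫ s in (0 : ℝ)..t, Real.exp (κ * s) * pastFlux M P.snd (s - M))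

/-- The flux through the inlet over the times `(-M, M)`: the past one is recorded in the profile,
the future one is `κ p`. The profile at time `t` is `y ↦ inletFlux (t - y)`. -/
noncomputable def inletFlux (κ M : ℝ) (P : StateSpace M) (s : ℝ) : ℝ :=
  pastFlux M P.snd s + (Ico 0 M).indicator (fun r => κ * atomMass κ M P r) s

section Past

variable {M : ℝ}

theorem ae_comp_sub_left {p : ℝ → Prop} (t : ℝ) (h : ∀ᵐ x, p x) : ∀ᵐ x : ℝ, p (t - x) :=
  (Measure.measurePreserving_sub_left volume t).quasiMeasurePreserving.ae h

theorem ae_comp_sub_right {p : ℝ → Prop} (t : ℝ) (h : ∀ᵐ x, p x) : ∀ᵐ x : ℝ, p (x - t) :=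
  (measurePreserving_sub_right volume t).quasiMeasurePreserving.ae h

theorem pastFlux_of_notMem {q : ℝ → ℝ} {s : ℝ} (h : s ∉ Ioo (-M) 0) : pastFlux M q s = 0 :=
  indicator_of_notMem (fun h' => h ⟨by linarith [h'.2], by linarith [h'.1]⟩) _

theorem pastFlux_of_mem {q : ℝ → ℝ} {s : ℝ} (h : s ∈ Ioo (-M) 0) : pastFlux M q s = q (-s) :=
  indicator_of_mem (show -s ∈ Ioo 0 M from ⟨by linarith [h.2], by linarith [h.1]⟩) _

theorem pastFlux_congr {q r : ℝ → ℝ} (h : q =ᵐ[volume.restrict (Ioo 0 M)] r) :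
    pastFlux M q =ᵐ[volume] pastFlux M r := by
  have h1 : (Ioo 0 M).indicator q =ᵐ[volume] (Ioo 0 M).indicator r :=
    (ae_eq_restrict_iff_indicator_ae_eq measurableSet_Ioo).1 h
  filter_upwards [ae_comp_sub_left 0 h1] with s hs
  simpa [pastFlux] using hs

theorem integrable_pastFlux {q : ℝ → ℝ} (h : IntegrableOn q (Ioo 0 M)) :
    Integrable (pastFlux M q) :=
  ((integrable_indicator_iff measurableSet_Ioo).2 h).comp_neg

theorem integral_abs_pastFlux (q : L1Space M) : ∫ s, |pastFlux M q s| = ‖q‖ := by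
  have e : (fun s => |pastFlux M q s|) = fun s => (Ioo 0 M).indicator (fun y => |q y|) (-s) := by
    ext s
    simp only [pastFlux]
    by_cases h : -s ∈ Ioo 0 M <;> simp [h]
  rw [e, integral_neg_eq_self (fun s => (Ioo 0 M).indicator (fun y => |q y|) s),
    integral_indicator measurableSet_Ioo, L1.norm_eq_integral_norm]
  rfl

theorem L1Space.integrableOn (q : L1Space M) : IntegrableOn q (Ioo 0 M) :=
  memLp_one_iff_integrable.1 (Lp.memLp q)

theorem pastFlux_add (q r : L1Space M) :
    pastFlux M (q + r : L1Space M) =ᵐ[volume] fun s => pastFlux M q s + pastFlux M r s := by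
  refine (pastFlux_congr (Lp.coeFn_add q r)).trans (Eventually.of_forall fun s => ?_)
  by_cases h : s ∈ Ioo (-M) 0
  · simp [pastFlux_of_mem h]
  · simp [pastFlux_of_notMem h]

theorem pastFlux_smul (c : ℝ) (q : L1Space M) :
    pastFlux M (c • q : L1Space M) =ᵐ[volume] fun s => c * pastFlux M q s := by
  refine (pastFlux_congr (Lp.coeFn_smul c q)).trans (Eventually.of_forall fun s => ?_)
  by_cases h : s ∈ Ioo (-M) 0
  · simp [pastFlux_of_mem h]
  · simp [pastFlux_of_notMem h]

end Past

section AtomMass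

variable {κ M : ℝ}

theorem intervalIntegrable_inflow (P : StateSpace M) (a b : ℝ) :
    IntervalIntegrable (fun s => pastFlux M P.snd (s - M)) volume a b :=
  ((integrable_pastFlux P.snd.integrableOn).comp_sub_right M).intervalIntegrable

theorem intervalIntegrable_exp_mul_inflow (P : StateSpace M) (a b : ℝ) :
    IntervalIntegrable (fun s => Real.exp (κ * s) * pastFlux M P.snd (s - M)) volume a b :=
  (intervalIntegrable_inflow P a b).continuousOn_mul (by fun_prop)

theorem atomMass_add (P Q : StateSpace M) (t : ℝ) :
    atomMass κ M (P + Q) t = atomMass κ M P t + atomMass κ M Q t := by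
  have e : ∫ s in (0 : ℝ)..t, Real.exp (κ * s) * pastFlux M (P + Q).snd (s - M) =
      (∫ s in (0 : ℝ)..t, Real.exp (κ * s) * pastFlux M P.snd (s - M)) +
        ∫ s in (0 : ℝ)..t, Real.exp (κ * s) * pastFlux M Q.snd (s - M) := by
    rw [← intervalIntegral.integral_add (intervalIntegrable_exp_mul_inflow P 0 t)
      (intervalIntegrable_exp_mul_inflow Q 0 t)]
    refine intervalIntegral.integral_congr_ae ?_
    filter_upwards [ae_comp_sub_right M (pastFlux_add P.snd Q.snd)] with s hs _
    rw [WithLp.add_snd, hs]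
    ring
  rw [atomMass, e, WithLp.add_fst, atomMass, atomMass]
  ring

theorem atomMass_smul (c : ℝ) (P : StateSpace M) (t : ℝ) :
    atomMass κ M (c • P) t = c * atomMass κ M P t := by
  have e : ∫ s in (0 : ℝ)..t, Real.exp (κ * s) * pastFlux M (c • P).snd (s - M) =
      c * ∫ s in (0 : ℝ)..t, Real.exp (κ * s) * pastFlux M P.snd (s - M) := by
    rw [← intervalIntegral.integral_const_mul]
    refine intervalIntegral.integral_congr_ae ?_
    filter_upwards [ae_comp_sub_right M (pastFlux_smul c P.snd)] with s hs _
    rw [WithLp.smul_snd, hs]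
    ring
  rw [atomMass, e, WithLp.smul_fst, atomMass, smul_eq_mul]
  ring

theorem atomMass_zero (P : StateSpace M) : atomMass κ M P 0 = P.fst := by
  simp [atomMass]

theorem continuous_atomMass (P : StateSpace M) : Continuous (atomMass κ M P) := by
  have h : Continuous fun t : ℝ =>
      ∫ s in (0 : ℝ)..t, Real.exp (κ * s) * pastFlux M P.snd (s - M) :=
    intervalIntegral.continuous_primitive (intervalIntegrable_exp_mul_inflow P) 0
  unfold atomMass
  fun_prop

theorem intervalIntegrable_mul_atomMass (P : StateSpace M) (a b : ℝ) :
    IntervalIntegrable (fun s => κ * atomMass κ M P s) volume a b :=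
  (continuous_const.mul (continuous_atomMass P)).intervalIntegrable _ _

theorem atomMass_eq_integral (P : StateSpace M) (t : ℝ) :
    atomMass κ M P t = P.fst + ∫ s in (0 : ℝ)..t,
      (pastFlux M P.snd (s - M) - κ * atomMass κ M P s) := by
  have hu : ContDiff ℝ 1 fun s : ℝ => Real.exp (-κ * s) := by fun_prop
  have hd : ∀ s : ℝ, deriv (fun s : ℝ => Real.exp (-κ * s)) s = -κ * Real.exp (-κ * s) := by
    intro s
    have := ((hasDerivAt_id s).const_mul (-κ)).exp.deriv
    simpa [mul_comm] using this
  have h := integral_deriv_mul_primitive P.fst (intervalIntegrable_exp_mul_inflow (κ := κ) P 0 t) hu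
  simp only [hd] at h
  have e1 : ∀ s : ℝ, Real.exp (κ * s) * pastFlux M P.snd (s - M) * Real.exp (-κ * s) =
      pastFlux M P.snd (s - M) := fun s => by
    rw [mul_right_comm, ← Real.exp_add]
    simp
  have e2 : ∀ s : ℝ, (P.fst + ∫ r in (0 : ℝ)..s, Real.exp (κ * r) * pastFlux M P.snd (r - M)) *
      (-κ * Real.exp (-κ * s)) = -(κ * atomMass κ M P s) := fun s => by
    rw [atomMass]
    ring
  simp only [e1, e2, mul_zero, Real.exp_zero, mul_one] at h
  rw [intervalIntegral.integral_neg] at h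
  rw [intervalIntegral.integral_sub (intervalIntegrable_inflow P 0 t)
    (intervalIntegrable_mul_atomMass P 0 t)]
  rw [show atomMass κ M P t = (P.fst + ∫ r in (0 : ℝ)..t,
    Real.exp (κ * r) * pastFlux M P.snd (r - M)) * Real.exp (-κ * t) by rw [atomMass, mul_comm]]
  linarith

theorem norm_state (P : StateSpace M) : ‖P‖ = |P.fst| + ‖P.snd‖ := by
  rw [WithLp.prod_norm_eq_of_L1, Real.norm_eq_abs]

theorem abs_atomMass_le (hκ : 0 ≤ κ) (P : StateSpace M) (t : ℝ) :
    |atomMass κ M P t| ≤ Real.exp (-κ * t) * Real.exp (κ * max t 0) * ‖P‖ := by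
  rw [atomMass, abs_mul, Real.abs_exp, mul_assoc]
  gcongr
  have hE : 1 ≤ Real.exp (κ * max t 0) := Real.one_le_exp (by positivity)
  have hI : Integrable fun s => |pastFlux M P.snd (s - M)| :=
    ((integrable_pastFlux P.snd.integrableOn).comp_sub_right M).abs
  have h : |∫ s in (0 : ℝ)..t, Real.exp (κ * s) * pastFlux M P.snd (s - M)| ≤
      Real.exp (κ * max t 0) * ‖P.snd‖ := by
    calc |∫ s in (0 : ℝ)..t, Real.exp (κ * s) * pastFlux M P.snd (s - M)|
        ≤ ∫ s in uIoc 0 t, |Real.exp (κ * s) * pastFlux M P.snd (s - M)| :=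
          intervalIntegral.norm_integral_le_integral_norm_uIoc
            (f := fun s => Real.exp (κ * s) * pastFlux M P.snd (s - M))
      _ ≤ ∫ s in uIoc 0 t, Real.exp (κ * max t 0) * |pastFlux M P.snd (s - M)| := by
          refine setIntegral_mono_on ?_ (hI.const_mul _).integrableOn measurableSet_uIoc
            fun s hs => ?_
          · exact (intervalIntegrable_iff.1 (intervalIntegrable_exp_mul_inflow P 0 t)).abs
          · rw [abs_mul, Real.abs_exp]
            have : s ≤ max t 0 := by
              rw [max_comm]
              exact hs.2
            gcongr
      _ ≤ ∫ s, Real.exp (κ * max t 0) * |pastFlux M P.snd (s - M)| :=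
          setIntegral_le_integral (hI.const_mul _)
            (Eventually.of_forall fun s => mul_nonneg (Real.exp_pos _).le (abs_nonneg _))
      _ = _ := by
          rw [integral_const_mul, integral_sub_right_eq_self (fun s => |pastFlux M P.snd s|),
            integral_abs_pastFlux]
  calc _ ≤ |P.fst| + Real.exp (κ * max t 0) * ‖P.snd‖ := (abs_add_le _ _).trans (by gcongr)
    _ ≤ Real.exp (κ * max t 0) * |P.fst| + Real.exp (κ * max t 0) * ‖P.snd‖ := by
        gcongr
        exact le_mul_of_one_le_left (abs_nonneg _) hE
    _ = _ := by rw [norm_state]; ring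

theorem abs_atomMass_le_norm (hκ : 0 ≤ κ) (P : StateSpace M) {t : ℝ} (ht : 0 ≤ t) :
    |atomMass κ M P t| ≤ ‖P‖ := by
  have := abs_atomMass_le hκ P t
  rwa [max_eq_left ht, ← Real.exp_add, show -κ * t + κ * t = 0 by ring, Real.exp_zero,
    one_mul] at this

end AtomMass

section InletFlux

variable {κ M : ℝ}

theorem inletFlux_of_neg (P : StateSpace M) {s : ℝ} (hs : s < 0) :
    inletFlux κ M P s = pastFlux M P.snd s := by
  simp [inletFlux, hs]

theorem inletFlux_of_mem (P : StateSpace M) {s : ℝ} (hs : s ∈ Ico 0 M) :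
    inletFlux κ M P s = κ * atomMass κ M P s := by
  rw [inletFlux, indicator_of_mem hs, pastFlux_of_notMem (fun h => absurd h.2 (not_lt.2 hs.1)),
    zero_add]

theorem inletFlux_add (P Q : StateSpace M) :
    inletFlux κ M (P + Q) =ᵐ[volume] fun s => inletFlux κ M P s + inletFlux κ M Q s := by
  filter_upwards [pastFlux_add P.snd Q.snd] with s hs
  rw [inletFlux, inletFlux, inletFlux, WithLp.add_snd, hs]
  by_cases h : s ∈ Ico 0 M
  · simp only [indicator_of_mem h, atomMass_add]
    ring
  · simp only [indicator_of_notMem h]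
    ring

theorem inletFlux_smul (c : ℝ) (P : StateSpace M) :
    inletFlux κ M (c • P) =ᵐ[volume] fun s => c * inletFlux κ M P s := by
  filter_upwards [pastFlux_smul c P.snd] with s hs
  rw [inletFlux, inletFlux, WithLp.smul_snd, hs]
  by_cases h : s ∈ Ico 0 M
  · simp only [indicator_of_mem h, atomMass_smul]
    ring
  · simp only [indicator_of_notMem h]
    ring

theorem integrableOn_atomMass (P : StateSpace M) :
    IntegrableOn (fun r => κ * atomMass κ M P r) (Ico 0 M) :=
  ((continuous_const.mul (continuous_atomMass P)).continuousOn.integrableOn_Icc).mono_set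
    Ico_subset_Icc_self

theorem integrable_inletFlux (P : StateSpace M) : Integrable (inletFlux κ M P) :=
  (integrable_pastFlux P.snd.integrableOn).add
    ((integrable_indicator_iff measurableSet_Ico).2 (integrableOn_atomMass P))

theorem integral_abs_inletFlux_le (hκ : 0 ≤ κ) (hM : 0 ≤ M) (P : StateSpace M) :
    ∫ s, |inletFlux κ M P s| ≤ (1 + κ * M) * ‖P‖ := by
  have h1 : Integrable fun s => |pastFlux M P.snd s| :=
    (integrable_pastFlux P.snd.integrableOn).abs
  have h2 : Integrable ((Ico 0 M).indicator fun _ : ℝ => κ * ‖P‖) :=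
    (integrable_indicator_iff measurableSet_Ico).2 (integrableOn_const (by simp))
  calc ∫ s, |inletFlux κ M P s|
      ≤ ∫ s, (|pastFlux M P.snd s| + (Ico 0 M).indicator (fun _ => κ * ‖P‖) s) := by
        refine integral_mono (integrable_inletFlux P).abs (h1.add h2) fun s => ?_
        refine (abs_add_le _ _).trans ?_
        gcongr
        by_cases h : s ∈ Ico 0 M
        · rw [indicator_of_mem h, indicator_of_mem h, abs_mul, abs_of_nonneg hκ]
          gcongr
          exact abs_atomMass_le_norm hκ P h.1
        · rw [indicator_of_notMem h, indicator_of_notMem h, abs_zero]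
    _ = ‖P.snd‖ + M * (κ * ‖P‖) := by
        rw [integral_add h1 h2, integral_abs_pastFlux, integral_indicator measurableSet_Ico]
        simp [hM]
    _ ≤ _ := by
        have := norm_state P
        have := abs_nonneg P.fst
        nlinarith

theorem memLp_inletFlux (P : StateSpace M) (t : ℝ) :
    MemLp (fun y => inletFlux κ M P (t - y)) 1 (volume.restrict (Ioo 0 M)) :=
  memLp_one_iff_integrable.2 ((integrable_inletFlux P).comp_sub_left t).integrableOn

end InletFlux

/-! ### The local semigroup -/

section LocalOp

variable {κ M : ℝ}

theorem norm_le_of_ae_eq_comp_sub {q : L1Space M} {w : ℝ → ℝ} (hw : Integrable w) (t : ℝ)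
    (h : q =ᵐ[volume.restrict (Ioo 0 M)] fun y => w (t - y)) : ‖q‖ ≤ ∫ s, |w s| := by
  rw [L1.norm_eq_integral_norm, ← integral_sub_left_eq_self (fun s => |w s|) volume t]
  rw [integral_congr_ae (h.mono fun y hy => congrArg norm hy)]
  exact setIntegral_le_integral (hw.comp_sub_left t).abs
    (Eventually.of_forall fun _ => abs_nonneg _)

/-- The state that arises from `P` by transport over the time `t`. -/
noncomputable def transport (κ M t : ℝ) (P : StateSpace M) : StateSpace M :=
  WithLp.toLp 1 (atomMass κ M P t, (memLp_inletFlux (κ := κ) P t).toLp _)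

theorem transport_snd (t : ℝ) (P : StateSpace M) :
    (transport κ M t P).snd =ᵐ[volume.restrict (Ioo 0 M)] fun y => inletFlux κ M P (t - y) :=
  MemLp.coeFn_toLp (memLp_inletFlux P t)

theorem StateSpace.ext {P Q : StateSpace M} (h1 : P.fst = Q.fst)
    (h2 : P.snd =ᵐ[volume.restrict (Ioo 0 M)] Q.snd) : P = Q := by
  have h3 : P.snd = Q.snd := Lp.ext h2
  exact WithLp.ofLp_injective 1 (Prod.ext h1 h3)

theorem transport_add (t : ℝ) (P Q : StateSpace M) :
    transport κ M t (P + Q) = transport κ M t P + transport κ M t Q := by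
  refine StateSpace.ext (atomMass_add P Q t) ?_
  rw [WithLp.add_snd]
  filter_upwards [transport_snd (κ := κ) t (P + Q), transport_snd (κ := κ) t P,
    transport_snd (κ := κ) t Q, ae_restrict_of_ae (ae_comp_sub_left t (inletFlux_add P Q)),
    Lp.coeFn_add (transport κ M t P).snd (transport κ M t Q).snd] with y h1 h2 h3 h4 h5
  rw [h1, h5, Pi.add_apply, h2, h3, h4]

theorem transport_smul (t c : ℝ) (P : StateSpace M) :
    transport κ M t (c • P) = c • transport κ M t P := by
  refine StateSpace.ext (atomMass_smul c P t) ?_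
  rw [WithLp.smul_snd]
  filter_upwards [transport_snd (κ := κ) t (c • P), transport_snd (κ := κ) t P,
    ae_restrict_of_ae (ae_comp_sub_left t (inletFlux_smul c P)),
    Lp.coeFn_smul c (transport κ M t P).snd] with y h1 h2 h4 h5
  rw [h1, h5, Pi.smul_apply, h2, h4, smul_eq_mul]

/-- Transport over the time `t` as an operator. It obeys the semigroup law up to time `M` only,
since `inletFlux` is cut off at that time. -/
noncomputable def localOp (κ M : ℝ) (hκ : 0 ≤ κ) (hM : 0 ≤ M) (t : ℝ) :
    StateSpace M →L[ℝ] StateSpace M :=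
  LinearMap.mkContinuous
    { toFun := transport κ M t
      map_add' := transport_add t
      map_smul' := transport_smul t }
    (Real.exp (-κ * t) * Real.exp (κ * max t 0) + (1 + κ * M)) fun P => by
      rw [norm_state, add_mul]
      exact add_le_add (abs_atomMass_le hκ P t)
        ((norm_le_of_ae_eq_comp_sub (integrable_inletFlux P) t (transport_snd t P)).trans
          (integral_abs_inletFlux_le hκ hM P))

variable {hκ : 0 ≤ κ} {hM : 0 ≤ M}

theorem localOp_fst (t : ℝ) (P : StateSpace M) :
    (localOp κ M hκ hM t P).fst = atomMass κ M P t := rfl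

theorem localOp_snd (t : ℝ) (P : StateSpace M) :
    (localOp κ M hκ hM t P).snd =ᵐ[volume.restrict (Ioo 0 M)]
      fun y => inletFlux κ M P (t - y) :=
  transport_snd t P

theorem localOp_zero : localOp κ M hκ hM 0 = 1 := by
  refine ContinuousLinearMap.ext fun P => StateSpace.ext ?_ ?_
  · rw [localOp_fst, atomMass_zero]
    rfl
  · refine (localOp_snd 0 P).trans ?_
    refine (ae_restrict_iff' measurableSet_Ioo).2 (Eventually.of_forall fun y hy => ?_)
    change inletFlux κ M P (0 - y) = P.snd y
    rw [zero_sub, inletFlux_of_neg P (by linarith [hy.1]),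
      pastFlux_of_mem ⟨by linarith [hy.2], by linarith [hy.1]⟩, neg_neg]

theorem pastFlux_localOp (t : ℝ) (P : StateSpace M) :
    ∀ᵐ s, s ∈ Ioo (-M) 0 →
      pastFlux M (localOp κ M hκ hM t P).snd s = inletFlux κ M P (t + s) := by
  filter_upwards [pastFlux_congr (localOp_snd (hκ := hκ) (hM := hM) t P)] with s hs hsm
  rw [hs, pastFlux_of_mem hsm, sub_neg_eq_add]

theorem atomMass_localOp {t r : ℝ} (hr : 0 ≤ r) (htr : t + r ≤ M) (ht : 0 ≤ t)
    (P : StateSpace M) : atomMass κ M (localOp κ M hκ hM t P) r = atomMass κ M P (t + r) := by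
  have e : ∫ s in (0 : ℝ)..r, Real.exp (κ * s) *
      pastFlux M (localOp κ M hκ hM t P).snd (s - M) =
      Real.exp (-κ * t) * ∫ s in t..t + r, Real.exp (κ * s) * pastFlux M P.snd (s - M) := by
    have hs := intervalIntegral.integral_comp_add_left (a := 0) (b := r)
      (fun s => Real.exp (κ * s) * pastFlux M P.snd (s - M)) t
    rw [add_zero] at hs
    rw [← hs, ← intervalIntegral.integral_const_mul, intervalIntegral.integral_of_le hr,
      intervalIntegral.integral_of_le hr, integral_Ioc_eq_integral_Ioo,
      integral_Ioc_eq_integral_Ioo]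
    refine setIntegral_congr_ae measurableSet_Ioo ?_
    filter_upwards [ae_comp_sub_right M (pastFlux_localOp (hκ := hκ) (hM := hM) t P)] with s hs hsm
    rw [hs ⟨by linarith [hsm.1], by linarith [hsm.2]⟩, inletFlux_of_neg P (by linarith [hsm.2]),
      ← mul_assoc, ← Real.exp_add]
    ring_nf
  rw [atomMass, e, localOp_fst, atomMass, atomMass,
    ← intervalIntegral.integral_add_adjacent_intervals
      (intervalIntegrable_exp_mul_inflow P 0 t) (intervalIntegrable_exp_mul_inflow P t (t + r)),
    mul_add (-κ) t r, Real.exp_add]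
  ring

theorem inletFlux_localOp {t : ℝ} (ht : 0 ≤ t) (P : StateSpace M) :
    ∀ᵐ s, s ∈ Ioo (-M) (M - t) →
      inletFlux κ M (localOp κ M hκ hM t P) s = inletFlux κ M P (t + s) := by
  filter_upwards [pastFlux_localOp (hκ := hκ) (hM := hM) t P] with s hs hsm
  rcases lt_or_ge s 0 with h | h
  · rw [inletFlux_of_neg _ h, hs ⟨hsm.1, h⟩]
  · rw [inletFlux_of_mem _ ⟨h, by linarith [hsm.2]⟩, atomMass_localOp h (by linarith [hsm.2]) ht,
      inletFlux_of_mem _ ⟨by linarith, by linarith [hsm.2]⟩]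

theorem localOp_add (s t : ℝ) (hs : 0 ≤ s) (ht : 0 ≤ t) (hst : s + t ≤ M) :
    localOp κ M hκ hM (s + t) = localOp κ M hκ hM s * localOp κ M hκ hM t := by
  refine ContinuousLinearMap.ext fun P => StateSpace.ext ?_ ?_
  · rw [mul_apply_eq_comp, localOp_fst, localOp_fst,
      atomMass_localOp hs (by linarith) ht, add_comm]
  · rw [mul_apply_eq_comp]
    refine (localOp_snd _ P).trans (EventuallyEq.trans ?_ (localOp_snd s _).symm)
    refine (ae_restrict_iff' measurableSet_Ioo).2 ?_
    filter_upwards [ae_comp_sub_left s (inletFlux_localOp (hκ := hκ) (hM := hM) ht P)] with y h hy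
    rw [h ⟨by linarith [hy.2], by linarith [hy.1]⟩]
    congr 1
    ring

theorem snd_ae_eq_inletFlux (P : StateSpace M) :
    P.snd =ᵐ[volume.restrict (Ioo 0 M)] fun y => inletFlux κ M P (-y) := by
  refine (ae_restrict_iff' measurableSet_Ioo).2 (Eventually.of_forall fun y hy => ?_)
  change P.snd y = inletFlux κ M P (-y)
  rw [inletFlux_of_neg P (by linarith [hy.1]),
    pastFlux_of_mem ⟨by linarith [hy.2], by linarith [hy.1]⟩, neg_neg]

theorem enorm_le_lintegral_of_ae_eq_comp_neg {q : L1Space M} {w : ℝ → ℝ}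
    (h : q =ᵐ[volume.restrict (Ioo 0 M)] fun y => w (-y)) : ‖q‖ₑ ≤ ∫⁻ s, ‖w s‖ₑ := by
  rw [Lp.enorm_def, eLpNorm_one_eq_lintegral_enorm,
    lintegral_congr_ae (h.mono fun y hy => congrArg enorm hy)]
  refine (setLIntegral_le_lintegral _ _).trans (le_of_eq ?_)
  exact (Measure.measurePreserving_neg volume).lintegral_comp_emb
    (MeasurableEquiv.neg ℝ).measurableEmbedding (fun s => ‖w s‖ₑ)

theorem tendsto_state {ι : Type*} {l : Filter ι} {F : ι → StateSpace M} {P : StateSpace M}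
    (h1 : Tendsto (fun i => (F i).fst) l (𝓝 P.fst))
    (h2 : Tendsto (fun i => (F i).snd) l (𝓝 P.snd)) : Tendsto F l (𝓝 P) :=
  ((WithLp.prod_continuous_toLp 1 ℝ (L1Space M)).tendsto _).comp (h1.prodMk_nhds h2)

theorem tendsto_localOp (P : StateSpace M) :
    Tendsto (fun t : ℝ≥0 => localOp κ M hκ hM t P) (𝓝 0) (𝓝 P) := by
  have hc : Tendsto (fun t : ℝ≥0 => (t : ℝ)) (𝓝 0) (𝓝 0) := NNReal.continuous_coe.tendsto 0
  refine tendsto_state ?_ ?_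
  · simp only [localOp_fst]
    have := ((continuous_atomMass (κ := κ) P).tendsto 0).comp hc
    rwa [atomMass_zero] at this
  · rw [tendsto_iff_edist_tendsto_0]
    refine tendsto_of_tendsto_of_tendsto_of_le_of_le tendsto_const_nhds
      ((tendsto_lintegral_translate (integrable_inletFlux (κ := κ) P)).comp hc)
      (fun _ => zero_le) fun t => ?_
    rw [edist_eq_enorm_sub]
    refine enorm_le_lintegral_of_ae_eq_comp_neg
      (w := fun x => inletFlux κ M P (t + x) - inletFlux κ M P x) ?_
    filter_upwards [Lp.coeFn_sub (localOp κ M hκ hM t P).snd P.snd,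
      localOp_snd (hκ := hκ) (hM := hM) t P, snd_ae_eq_inletFlux (κ := κ) P] with y h1 h2 h3
    rw [h1, Pi.sub_apply, h2, h3, sub_eq_add_neg (t : ℝ) y]

end LocalOp

/-! ### The generator of the local semigroup -/

section Generator

variable {κ M : ℝ}

theorem continuous_intervalIntegral_L1 {b : ℝ} (hb : b ∈ Icc 0 M) :
    Continuous fun q : L1Space M => ∫ y in (0 : ℝ)..b, q y := by
  have h := continuous_setIntegral (X := ℝ) (E := ℝ) (μ := volume.restrict (Ioo 0 M)) (Ioo 0 b)
  refine h.congr fun q => ?_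
  rw [Measure.restrict_restrict measurableSet_Ioo, Ioo_inter_Ioo, sup_idem, min_eq_left hb.2,
    setIntegral_Ioo_eq_intervalIntegral hb.1]

theorem L1Space.intervalIntegrable (q : L1Space M) {b : ℝ} (hb : b ∈ Icc 0 M) :
    IntervalIntegrable q volume 0 b :=
  intervalIntegrable_of_integrableOn_Ioo q.integrableOn ⟨le_rfl, hb.1.trans hb.2⟩ hb

theorem intervalIntegral_congr_ae_Ioo {f g : ℝ → ℝ} {b : ℝ} (hb : b ∈ Icc 0 M)
    (h : f =ᵐ[volume.restrict (Ioo 0 M)] g) : ∫ y in (0 : ℝ)..b, f y = ∫ y in (0 : ℝ)..b, g y := by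
  rw [← setIntegral_Ioo_eq_intervalIntegral hb.1, ← setIntegral_Ioo_eq_intervalIntegral hb.1]
  exact integral_congr_ae (ae_restrict_of_ae_restrict_of_subset (Ioo_subset_Ioo_right hb.2) h)

theorem intervalIntegral_of_ae_eq_comp_sub {q w : ℝ → ℝ} {t b : ℝ} (hb : b ∈ Icc 0 M)
    (h : q =ᵐ[volume.restrict (Ioo 0 M)] fun y => w (t - y)) :
    ∫ y in (0 : ℝ)..b, q y = ∫ s in t - b..t, w s := by
  rw [intervalIntegral_congr_ae_Ioo hb h, intervalIntegral.integral_comp_sub_left, sub_zero]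

theorem intervalIntegrable_inletFlux (P : StateSpace M) (a b : ℝ) :
    IntervalIntegrable (inletFlux κ M P) volume a b :=
  (integrable_inletFlux P).intervalIntegrable

theorem integral_inletFlux_of_nonneg (P : StateSpace M) {t : ℝ} (ht : 0 ≤ t) (htM : t ≤ M) :
    ∫ s in (0 : ℝ)..t, inletFlux κ M P s = ∫ s in (0 : ℝ)..t, κ * atomMass κ M P s := by
  rw [← setIntegral_Ioo_eq_intervalIntegral ht, ← setIntegral_Ioo_eq_intervalIntegral ht]
  exact setIntegral_congr_fun measurableSet_Ioo fun s hs =>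
    inletFlux_of_mem P ⟨hs.1.le, hs.2.trans_le htM⟩

variable {hκ : 0 ≤ κ} {hM : 0 ≤ M}

/-- Transport conserves the total mass. -/
theorem mass_localOp {t : ℝ} (ht : 0 ≤ t) (htM : t ≤ M) (P : StateSpace M) :
    (localOp κ M hκ hM t P).fst + ∫ y in (0 : ℝ)..M, (localOp κ M hκ hM t P).snd y =
      P.fst + ∫ y in (0 : ℝ)..M, P.snd y := by
  have hw := intervalIntegrable_inletFlux (κ := κ) P
  rw [intervalIntegral_of_ae_eq_comp_sub ⟨hM, le_rfl⟩ (localOp_snd t P),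
    intervalIntegral_of_ae_eq_comp_sub (t := 0) (w := inletFlux κ M P) ⟨hM, le_rfl⟩
      (by simpa using snd_ae_eq_inletFlux P),
    localOp_fst, atomMass_eq_integral, intervalIntegral.integral_sub
      (intervalIntegrable_inflow P 0 t)
      (intervalIntegrable_mul_atomMass P 0 t), ← integral_inletFlux_of_nonneg P ht htM,
    intervalIntegral.integral_comp_sub_right (fun s => pastFlux M P.snd s) M]
  have e : ∫ s in 0 - M..t - M, pastFlux M P.snd s = ∫ s in 0 - M..t - M, inletFlux κ M P s := by
    rw [intervalIntegral.integral_of_le (by linarith), intervalIntegral.integral_of_le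
      (by linarith), integral_Ioc_eq_integral_Ioo, integral_Ioc_eq_integral_Ioo]
    exact setIntegral_congr_fun measurableSet_Ioo fun s hs =>
      (inletFlux_of_neg P (by linarith [hs.2])).symm
  rw [e, ← intervalIntegral.integral_add_adjacent_intervals (hw (t - M) 0) (hw 0 t),
    ← intervalIntegral.integral_add_adjacent_intervals (hw (0 - M) (t - M)) (hw (t - M) 0)]
  ring

theorem intervalIntegral_smul_sub_snd (c : ℝ) (P Q : StateSpace M) {b : ℝ} (hb : b ∈ Icc 0 M) :
    ∫ y in (0 : ℝ)..b, (c • (P - Q)).snd y =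
      c * ((∫ y in (0 : ℝ)..b, P.snd y) - ∫ y in (0 : ℝ)..b, Q.snd y) := by
  rw [← intervalIntegral.integral_sub (P.snd.intervalIntegrable hb) (Q.snd.intervalIntegrable hb),
    ← intervalIntegral.integral_const_mul]
  refine intervalIntegral_congr_ae_Ioo hb ?_
  rw [WithLp.smul_snd, WithLp.sub_snd]
  filter_upwards [Lp.coeFn_smul c (P.snd - Q.snd), Lp.coeFn_sub P.snd Q.snd] with y h1 h2
  rw [h1, Pi.smul_apply, h2, Pi.sub_apply, smul_eq_mul]

theorem fst_quotient {t : ℝ} (ht : 0 ≤ t) (htM : t ≤ M) (c : ℝ) (P : StateSpace M) :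
    (c • (localOp κ M hκ hM t P - P)).fst =
      -∫ y in (0 : ℝ)..M, (c • (localOp κ M hκ hM t P - P)).snd y := by
  rw [intervalIntegral_smul_sub_snd c _ _ ⟨hM, le_rfl⟩, WithLp.smul_fst, WithLp.sub_fst,
    smul_eq_mul, neg_mul_eq_mul_neg]
  congr 1
  linarith [mass_localOp (hκ := hκ) (hM := hM) ht htM P]

theorem integral_quotient (t c : ℝ) (P : StateSpace M) {b : ℝ} (hb : b ∈ Icc 0 M) :
    ∫ y in (0 : ℝ)..b, (c • (localOp κ M hκ hM t P - P)).snd y =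
      c * (∫ s in (0 : ℝ)..t, inletFlux κ M P s) - c * ∫ s in -b..-b + t, inletFlux κ M P s := by
  have hw := intervalIntegrable_inletFlux (κ := κ) P
  rw [intervalIntegral_smul_sub_snd c _ _ hb,
    intervalIntegral_of_ae_eq_comp_sub hb (localOp_snd t P),
    intervalIntegral_of_ae_eq_comp_sub (t := 0) (w := inletFlux κ M P) hb
      (by simpa using snd_ae_eq_inletFlux P), ← mul_sub, zero_sub,
    show t - b = -b + t by ring]
  congr 1
  rw [← intervalIntegral.integral_add_adjacent_intervals (hw (-b) 0) (hw 0 (-b + t)),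
    ← intervalIntegral.integral_add_adjacent_intervals (hw 0 (-b + t)) (hw (-b + t) t)]
  ring

/-- If the difference quotients of the orbit of `P` converge to `Z`, integrate them over `(0, y)`:
the Lebesgue differentiation theorem identifies the limit for almost every `y`. -/
theorem graph_of_tendsto_quotient (hM0 : 0 < M) {P Z : StateSpace M}
    (h : Tendsto (fun h : ℝ≥0 => (h : ℝ)⁻¹ • (localOp κ M hκ hM h P - P)) (𝓝[>] 0) (𝓝 Z)) :
    Z.fst = -(∫ y in (0 : ℝ)..M, Z.snd y) ∧
      P.snd =ᵐ[volume.restrict (Ioo 0 M)] fun y => κ * P.fst - ∫ r in (0 : ℝ)..y, Z.snd r := by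
  have hsmall : ∀ᶠ h : ℝ≥0 in 𝓝[>] 0, (h : ℝ) < M :=
    nhdsWithin_le_nhds (eventually_nnreal_lt hM0)
  have hf := ((WithLp.continuous_fst 1 ℝ (L1Space M)).tendsto Z).comp h
  have hs := ((WithLp.continuous_snd 1 ℝ (L1Space M)).tendsto Z).comp h
  have hint : ∀ b ∈ Icc 0 M, Tendsto (fun h : ℝ≥0 => ∫ y in (0 : ℝ)..b,
      ((h : ℝ)⁻¹ • (localOp κ M hκ hM h P - P)).snd y) (𝓝[>] 0)
      (𝓝 (∫ y in (0 : ℝ)..b, Z.snd y)) := fun b hb =>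
    ((continuous_intervalIntegral_L1 hb).tendsto _).comp hs
  refine ⟨tendsto_nhds_unique hf ((hint M ⟨hM, le_rfl⟩).neg.congr' ?_), ?_⟩
  · filter_upwards [hsmall] with h hh
    exact (fst_quotient h.2 hh.le _ P).symm
  have h0 : Tendsto (fun h : ℝ≥0 => (h : ℝ)⁻¹ * ∫ s in (0 : ℝ)..h, inletFlux κ M P s) (𝓝[>] 0)
      (𝓝 (κ * P.fst)) := by
    have hp := continuous_atomMass (κ := κ) P
    have hc : Continuous fun s => κ * atomMass κ M P s := by fun_prop
    have hd : HasDerivAt (fun u => ∫ s in (0 : ℝ)..u, κ * atomMass κ M P s)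
        (κ * atomMass κ M P 0) 0 :=
      intervalIntegral.integral_hasDerivAt_right (hc.intervalIntegrable _ _)
        (hc.stronglyMeasurableAtFilter _ _) hc.continuousAt
    have := hd.tendsto_slope_zero_right.comp tendsto_coe_nhdsGT
    rw [atomMass_zero] at this
    refine this.congr' ?_
    filter_upwards [hsmall] with h hh
    rw [integral_inletFlux_of_nonneg P h.coe_nonneg hh.le]
    simp only [Function.comp_apply, zero_add, intervalIntegral.integral_same, sub_zero, smul_eq_mul]
  have hleb := ae_comp_sub_left 0
    (LocallyIntegrable.ae_hasDerivAt_integral (integrable_inletFlux (κ := κ) P).locallyIntegrable)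
  filter_upwards [snd_ae_eq_inletFlux (κ := κ) P, ae_restrict_of_ae hleb,
    ae_restrict_mem measurableSet_Ioo] with y hy1 hy2 hy
  rw [zero_sub] at hy2
  have h1 := (hy2 (-y)).tendsto_slope_zero_right.comp tendsto_coe_nhdsGT
  simp only [intervalIntegral.integral_same, sub_zero] at h1
  have h2 := tendsto_nhds_unique (hint y ⟨hy.1.le, hy.2.le⟩) ((h0.sub h1).congr fun h => by
    rw [integral_quotient _ _ _ ⟨hy.1.le, hy.2.le⟩]
    rfl)
  rw [hy1, h2]
  ring

/-- The derivative of the inlet flux of a state in the domain of the generator. -/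
noncomputable def inletFluxDeriv (κ M : ℝ) (P Z : StateSpace M) (s : ℝ) : ℝ :=
  pastFlux M Z.snd s +
    (Ioo 0 M).indicator (fun r => κ * (pastFlux M P.snd (r - M) - κ * atomMass κ M P r)) s

theorem intervalIntegrable_balance (P : StateSpace M) (a b : ℝ) :
    IntervalIntegrable (fun r => pastFlux M P.snd (r - M) - κ * atomMass κ M P r) volume a b :=
  (intervalIntegrable_inflow P a b).sub
    (intervalIntegrable_mul_atomMass P a b)

theorem integrable_inletFluxDeriv (hM : 0 ≤ M) (P Z : StateSpace M) :
    Integrable (inletFluxDeriv κ M P Z) := by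
  refine (integrable_pastFlux Z.snd.integrableOn).add
    ((integrable_indicator_iff measurableSet_Ioo).2 ?_)
  have := (intervalIntegrable_balance (κ := κ) P 0 M).const_mul κ
  rw [intervalIntegrable_iff, uIoc_of_le hM] at this
  exact this.mono_set Ioo_subset_Ioc_self

theorem inletFluxDeriv_of_neg (P Z : StateSpace M) {s : ℝ} (hs : s ∈ Ioo (-M) 0) :
    inletFluxDeriv κ M P Z s = Z.snd (-s) := by
  rw [inletFluxDeriv, pastFlux_of_mem hs,
    indicator_of_notMem (fun h => absurd h.1 (not_lt.2 hs.2.le)), add_zero]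

theorem inletFlux_eq_primitive {P Z : StateSpace M}
    (hq : P.snd =ᵐ[volume.restrict (Ioo 0 M)] fun y => κ * P.fst - ∫ r in (0 : ℝ)..y, Z.snd r) :
    ∀ᵐ s, s ∈ Ioo (-M) M → inletFlux κ M P s =
      κ * P.fst + ∫ r in (0 : ℝ)..s, inletFluxDeriv κ M P Z r := by
  filter_upwards [pastFlux_congr hq] with s hs hsm
  rcases lt_or_ge s 0 with h | h
  · rw [inletFlux_of_neg P h, hs, pastFlux_of_mem ⟨hsm.1, h⟩, sub_eq_add_neg,
      intervalIntegral.integral_symm s 0]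
    congr 2
    rw [intervalIntegral.integral_of_le h.le, integral_Ioc_eq_integral_Ioo,
      setIntegral_congr_fun measurableSet_Ioo fun r hr =>
        inletFluxDeriv_of_neg P Z ⟨hsm.1.trans hr.1, hr.2⟩, ← integral_Ioc_eq_integral_Ioo,
      ← intervalIntegral.integral_of_le h.le, intervalIntegral.integral_comp_neg, neg_zero]
  · rw [inletFlux_of_mem P ⟨h, hsm.2⟩, atomMass_eq_integral, mul_add,
      ← intervalIntegral.integral_const_mul]
    congr 1
    rw [← setIntegral_Ioo_eq_intervalIntegral h, ← setIntegral_Ioo_eq_intervalIntegral h]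
    refine setIntegral_congr_fun measurableSet_Ioo fun r hr => ?_
    rw [inletFluxDeriv, pastFlux_of_notMem (fun h' => absurd h'.2 (not_lt.2 hr.1.le)),
      indicator_of_mem (show r ∈ Ioo 0 M from ⟨hr.1, hr.2.trans hsm.2⟩), zero_add]

/-- If the profile of `P` is absolutely continuous with boundary value `κ p₀`, then the inlet flux
is absolutely continuous through time zero, and its difference quotients converge in `L¹`. -/
theorem tendsto_quotient_of_graph (hM0 : 0 < M) {P Z : StateSpace M}
    (hz : Z.fst = -(∫ y in (0 : ℝ)..M, Z.snd y))
    (hq : P.snd =ᵐ[volume.restrict (Ioo 0 M)] fun y => κ * P.fst - ∫ r in (0 : ℝ)..y, Z.snd r) :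
    Tendsto (fun h : ℝ≥0 => (h : ℝ)⁻¹ • (localOp κ M hκ hM h P - P)) (𝓝[>] 0) (𝓝 Z) := by
  have hsmall : ∀ᶠ h : ℝ≥0 in 𝓝[>] 0, (h : ℝ) < M :=
    nhdsWithin_le_nhds (eventually_nnreal_lt hM0)
  have hω := integrable_inletFluxDeriv (κ := κ) hM P Z
  have hs : Tendsto (fun h : ℝ≥0 => ((h : ℝ)⁻¹ • (localOp κ M hκ hM h P - P)).snd) (𝓝[>] 0)
      (𝓝 Z.snd) := by
    rw [tendsto_iff_edist_tendsto_0]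
    refine tendsto_of_tendsto_of_tendsto_of_le_of_le' tendsto_const_nhds
      ((tendsto_lintegral_diffQuot hω).comp tendsto_coe_nhdsGT)
      (Eventually.of_forall fun _ => zero_le) ?_
    filter_upwards [hsmall] with h hh
    rw [edist_eq_enorm_sub]
    refine enorm_le_lintegral_of_ae_eq_comp_neg (w := fun x => (h : ℝ)⁻¹ *
      (∫ r in x..x + h, inletFluxDeriv κ M P Z r) - inletFluxDeriv κ M P Z x) ?_
    have hp := inletFlux_eq_primitive hq
    filter_upwards [Lp.coeFn_sub ((h : ℝ)⁻¹ • (localOp κ M hκ hM h P - P)).snd Z.snd,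
      Lp.coeFn_smul (h : ℝ)⁻¹ (localOp κ M hκ hM h P - P).snd,
      Lp.coeFn_sub (localOp κ M hκ hM h P).snd P.snd,
      localOp_snd (hκ := hκ) (hM := hM) h P, snd_ae_eq_inletFlux (κ := κ) P,
      ae_restrict_of_ae (ae_comp_sub_left (h : ℝ) hp), ae_restrict_of_ae (ae_comp_sub_left 0 hp),
      ae_restrict_mem measurableSet_Ioo] with y h1 h2 h3 h4 h5 h6 h7 hy
    have hh0 : (0 : ℝ) ≤ h := h.2
    rw [zero_sub] at h7
    rw [h1, Pi.sub_apply, WithLp.smul_snd, h2, Pi.smul_apply, WithLp.sub_snd, h3, Pi.sub_apply,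
      h4, h5, h6 ⟨by linarith [hy.2], by linarith [hy.1]⟩,
      h7 ⟨by linarith [hy.2], by linarith [hy.1]⟩,
      inletFluxDeriv_of_neg P Z ⟨by linarith [hy.2], by linarith [hy.1]⟩, neg_neg, smul_eq_mul,
      ← intervalIntegral.integral_add_adjacent_intervals (a := 0) (b := -y) (c := h - y)
        hω.intervalIntegrable hω.intervalIntegrable, show -y + (h : ℝ) = h - y by ring]
    ring
  refine tendsto_state ?_ hs
  rw [hz]
  have := (((continuous_intervalIntegral_L1 (M := M) ⟨hM, le_rfl⟩).tendsto _).comp hs).neg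
  refine this.congr' ?_
  filter_upwards [hsmall] with h hh
  exact (fst_quotient h.2 hh.le _ P).symm

end Generator

/-! ### Compactness after one full transit -/

section Compact

variable {κ M : ℝ}

theorem integral_abs_balance_le (hκ : 0 ≤ κ) (hM : 0 ≤ M) (P : StateSpace M) :
    ∫ r in (0 : ℝ)..M, |pastFlux M P.snd (r - M) - κ * atomMass κ M P r| ≤
      (1 + κ * M) * ‖P‖ := by
  have h1 := (intervalIntegrable_inflow P 0 M).abs
  have h2 : ∫ r in (0 : ℝ)..M, |pastFlux M P.snd (r - M)| ≤ ‖P.snd‖ := by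
    rw [intervalIntegral.integral_of_le hM, ← integral_abs_pastFlux,
      ← integral_sub_right_eq_self (fun s => |pastFlux M P.snd s|) M]
    exact setIntegral_le_integral
      ((integrable_pastFlux P.snd.integrableOn).comp_sub_right M).abs
      (Eventually.of_forall fun _ => abs_nonneg _)
  calc ∫ r in (0 : ℝ)..M, |pastFlux M P.snd (r - M) - κ * atomMass κ M P r|
      ≤ ∫ r in (0 : ℝ)..M, (|pastFlux M P.snd (r - M)| + κ * ‖P‖) := by
        refine intervalIntegral.integral_mono_on hM (intervalIntegrable_balance P 0 M).abs
          (h1.add (by simp)) fun r hr => (abs_sub _ _).trans ?_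
        rw [abs_mul, abs_of_nonneg hκ]
        gcongr
        exact abs_atomMass_le_norm hκ P hr.1
    _ = (∫ r in (0 : ℝ)..M, |pastFlux M P.snd (r - M)|) + M * (κ * ‖P‖) := by
        rw [intervalIntegral.integral_add h1 (by simp)]
        simp only [intervalIntegral.integral_const, sub_zero, smul_eq_mul]
    _ ≤ _ := by
        have := norm_state P
        have := abs_nonneg P.fst
        nlinarith

theorem abs_atomMass_sub_le (P : StateSpace M) {a b : ℝ} (hab : a ≤ b) :
    |atomMass κ M P b - atomMass κ M P a| ≤
      ∫ r in a..b, |pastFlux M P.snd (r - M) - κ * atomMass κ M P r| := by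
  rw [atomMass_eq_integral P b, atomMass_eq_integral P a, add_sub_add_left_eq_sub,
    intervalIntegral.integral_interval_sub_left (intervalIntegrable_balance P 0 b)
      (intervalIntegrable_balance P 0 a)]
  exact intervalIntegral.abs_integral_le_integral_abs hab

/-- A function `f` whose increments are bounded by integrals of `D` is approximated in `L¹` by
its values at the left end points of a grid of mesh `δ`. -/
theorem sum_integral_abs_sub_le {f D : ℝ → ℝ} {δ : ℝ} {n : ℕ} (hδ : 0 ≤ δ) (hf : Continuous f)
    (hD : ∀ a b, IntervalIntegrable D volume a b) (hD0 : ∀ r, 0 ≤ D r)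
    (h : ∀ a b, a ≤ b → |f b - f a| ≤ ∫ r in a..b, D r) :
    ∑ i ∈ Finset.range n, ∫ s in (i * δ)..((i + 1 : ℕ) * δ), |f s - f (i * δ)| ≤
      δ * ∫ r in (0 : ℝ)..n * δ, D r := by
  have e := intervalIntegral.sum_integral_adjacent_intervals (f := D) (μ := volume)
    (a := fun i : ℕ => (i : ℝ) * δ) (n := n) fun k _ => hD _ _
  rw [Nat.cast_zero, zero_mul] at e
  rw [← e, Finset.mul_sum]
  refine Finset.sum_le_sum fun i _ => ?_
  have hle : (i : ℝ) * δ ≤ (i + 1 : ℕ) * δ := by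
    push_cast
    nlinarith
  calc ∫ s in (i * δ)..((i + 1 : ℕ) * δ), |f s - f (i * δ)|
      ≤ ∫ s in (i * δ)..((i + 1 : ℕ) * δ), (∫ r in (i * δ)..((i + 1 : ℕ) * δ), D r) := by
        refine intervalIntegral.integral_mono_on hle
          ((hf.sub continuous_const).abs.intervalIntegrable _ _) (by simp) fun s hs => ?_
        exact (h _ _ hs.1).trans (intervalIntegral.integral_mono_interval le_rfl hs.1 hs.2
          (Eventually.of_forall hD0) (hD _ _))
    _ = _ := by
        rw [intervalIntegral.integral_const, smul_eq_mul]
        push_cast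
        ring

theorem sum_indicator_grid {δ : ℝ} (c : ℕ → ℝ) {n i : ℕ} (hi : i < n) {s : ℝ}
    (hs : s ∈ Ioo (i * δ) ((i + 1 : ℕ) * δ)) :
    ∑ j ∈ Finset.range n, c j * (Ioo (j * δ) ((j + 1 : ℕ) * δ)).indicator 1 s = c i := by
  have hδ : 0 < δ := by
    have := hs.1.trans hs.2
    push_cast at this
    linarith
  rw [Finset.sum_eq_single_of_mem i (Finset.mem_range.2 hi), indicator_of_mem hs, Pi.one_apply,
    mul_one]
  intro j _ hji
  rw [indicator_of_notMem, mul_zero]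
  intro hj
  have h1 : (i : ℝ) < (j + 1 : ℕ) := lt_of_mul_lt_mul_right (hs.1.trans hj.2) hδ.le
  have h2 : (j : ℝ) < (i + 1 : ℕ) := lt_of_mul_lt_mul_right (hj.1.trans hs.2) hδ.le
  have h3 : i < j + 1 := by exact_mod_cast h1
  have h4 : j < i + 1 := by exact_mod_cast h2
  omega

theorem memLp_gridIndicator (a b : ℝ) :
    MemLp (fun y => (Ioo a b).indicator (1 : ℝ → ℝ) (M - y)) 1 (volume.restrict (Ioo 0 M)) := by
  refine memLp_one_iff_integrable.2 (Integrable.integrableOn ?_)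
  refine Integrable.comp_sub_left (f := (Ioo a b).indicator (1 : ℝ → ℝ)) ?_ M
  rw [integrable_indicator_iff measurableSet_Ioo]
  exact integrableOn_const (by simp)

/-- The functional `P ↦ p(t)`. -/
noncomputable def atomMassL (hκ : 0 ≤ κ) (hM : 0 ≤ M) (t : ℝ) : StateSpace M →L[ℝ] ℝ :=
  (WithLp.fstL 1 ℝ ℝ (L1Space M)).comp (localOp κ M hκ hM t)

/-- A finite-rank approximation of transport over the time `M`: the function `p` on `[0, M]`,
which makes up the new profile, is replaced by its values on a grid of mesh `δ`. -/
noncomputable def gridOp (hκ : 0 ≤ κ) (hM : 0 ≤ M) (n : ℕ) (δ : ℝ) :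
    StateSpace M →L[ℝ] StateSpace M :=
  (atomMassL hκ hM M).smulRight (WithLp.toLp 1 (1, 0)) +
    ∑ i ∈ Finset.range n, (atomMassL hκ hM (i * δ)).smulRight
      (WithLp.toLp 1 (0, κ • (memLp_gridIndicator (M := M) (i * δ) ((i + 1 : ℕ) * δ)).toLp _))

variable {hκ : 0 ≤ κ} {hM : 0 ≤ M}

theorem isCompactOperator_smulRight (ℓ : StateSpace M →L[ℝ] ℝ) (Q : StateSpace M) :
    IsCompactOperator (ℓ.smulRight Q) := by
  have h : IsCompactOperator ℓ := isCompactOperator_of_locallyCompactSpace_dom ℓ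
  exact h.continuous_comp (g := fun r : ℝ => r • Q) (by fun_prop)

theorem isCompactOperator_sum {ι : Type*} (s : Finset ι) {F : ι → StateSpace M →L[ℝ] StateSpace M}
    (h : ∀ i, IsCompactOperator (F i)) :
    IsCompactOperator (∑ i ∈ s, F i : StateSpace M →L[ℝ] StateSpace M) := by
  classical
  induction s using Finset.induction_on with
  | empty => exact isCompactOperator_zero
  | insert i s hi ih =>
    rw [Finset.sum_insert hi]
    exact (h i).add ih

theorem isCompactOperator_gridOp (n : ℕ) (δ : ℝ) : IsCompactOperator (gridOp hκ hM n δ) :=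
  (isCompactOperator_smulRight _ _).add
    (isCompactOperator_sum _ fun _ => isCompactOperator_smulRight _ _)

theorem gridOp_apply (n : ℕ) (δ : ℝ) (P : StateSpace M) :
    gridOp hκ hM n δ P = WithLp.toLp 1 (atomMass κ M P M, ∑ i ∈ Finset.range n,
      (κ * atomMass κ M P (i * δ)) •
        (memLp_gridIndicator (M := M) (i * δ) ((i + 1 : ℕ) * δ)).toLp _) := by
  have h : gridOp hκ hM n δ P = atomMass κ M P M • WithLp.toLp 1 (1, 0) +
      ∑ i ∈ Finset.range n, atomMass κ M P (i * δ) • WithLp.toLp 1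
        (0, κ • (memLp_gridIndicator (M := M) (i * δ) ((i + 1 : ℕ) * δ)).toLp _) := by
    rw [gridOp, add_apply, sum_apply]
    rfl
  rw [h]
  simp only [← WithLp.toLp_smul, ← WithLp.toLp_sum, ← WithLp.toLp_add]
  congr 1
  ext1
  · simp [Prod.fst_sum]
  · simp [Prod.snd_sum, smul_smul, mul_comm κ]

theorem L1Space.coeFn_sum {ι : Type*} (s : Finset ι) (F : ι → L1Space M) :
    (∑ i ∈ s, F i : L1Space M) =ᵐ[volume.restrict (Ioo 0 M)] fun y => ∑ i ∈ s, F i y := by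
  classical
  induction s using Finset.induction_on with
  | empty =>
    simp only [Finset.sum_empty]
    exact Lp.coeFn_zero ..
  | insert i s hi ih =>
    rw [Finset.sum_insert hi]
    filter_upwards [Lp.coeFn_add (F i) (∑ j ∈ s, F j), ih] with y h1 h2
    rw [h1, Pi.add_apply, h2, Finset.sum_insert hi]

theorem norm_localOp_sub_gridOp_le {n : ℕ} {δ : ℝ} (hδ : 0 ≤ δ) (hn : n * δ = M) :
    ‖localOp κ M hκ hM M - gridOp hκ hM n δ‖ ≤ κ * δ * (1 + κ * M) := by
  refine ContinuousLinearMap.opNorm_le_bound _ (by positivity) fun P => ?_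
  have hpc := continuous_atomMass (κ := κ) P
  set G : ℝ → ℝ := fun s => κ * atomMass κ M P s - ∑ i ∈ Finset.range n,
    κ * atomMass κ M P (i * δ) * (Ioo (i * δ) ((i + 1 : ℕ) * δ)).indicator 1 s with hG
  have hsnd : ((localOp κ M hκ hM M - gridOp hκ hM n δ) P).snd
      =ᵐ[volume.restrict (Ioo 0 M)] fun y => G (M - y) := by
    set F : ℕ → L1Space M := fun i => (κ * atomMass κ M P (i * δ)) •
      (memLp_gridIndicator (M := M) (i * δ) ((i + 1 : ℕ) * δ)).toLp _ with hF
    have hs : ∀ i ∈ Finset.range n, F i =ᵐ[volume.restrict (Ioo 0 M)] fun y =>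
        κ * atomMass κ M P (i * δ) *
          (Ioo (i * δ) ((i + 1 : ℕ) * δ)).indicator 1 (M - y) := fun i _ => by
      filter_upwards [Lp.coeFn_smul (κ * atomMass κ M P (i * δ))
        ((memLp_gridIndicator (M := M) (i * δ) ((i + 1 : ℕ) * δ)).toLp _),
        MemLp.coeFn_toLp (memLp_gridIndicator (M := M) (i * δ) ((i + 1 : ℕ) * δ))] with y h1 h2
      rw [hF, h1, Pi.smul_apply, h2, smul_eq_mul]
    rw [sub_apply, WithLp.sub_snd, gridOp_apply]
    filter_upwards [Lp.coeFn_sub (localOp κ M hκ hM M P).snd (∑ i ∈ Finset.range n, F i),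
      localOp_snd (hκ := hκ) (hM := hM) M P, L1Space.coeFn_sum (Finset.range n) F,
      (eventually_all_finset (Finset.range n)).2 hs,
      ae_restrict_mem measurableSet_Ioo] with y h1 h2 h3 h4 hy
    refine h1.trans ?_
    rw [Pi.sub_apply, h2, inletFlux_of_mem P ⟨by linarith [hy.2], by linarith [hy.1]⟩, h3,
      Finset.sum_congr rfl h4]
  have hfst : ((localOp κ M hκ hM M - gridOp hκ hM n δ) P).fst = 0 := by
    rw [sub_apply, WithLp.sub_fst, gridOp_apply, localOp_fst, WithLp.toLp_fst, sub_self]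
  have hcell : ∀ i < n, ∫ s in (i * δ)..((i + 1 : ℕ) * δ), |G s| =
      κ * ∫ s in (i * δ)..((i + 1 : ℕ) * δ), |atomMass κ M P s - atomMass κ M P (i * δ)| := by
    intro i hi
    have hle : (i : ℝ) * δ ≤ (i + 1 : ℕ) * δ := by
      push_cast
      nlinarith
    rw [← intervalIntegral.integral_const_mul, intervalIntegral.integral_of_le hle,
      intervalIntegral.integral_of_le hle, integral_Ioc_eq_integral_Ioo,
      integral_Ioc_eq_integral_Ioo]
    refine setIntegral_congr_fun measurableSet_Ioo fun s hs => ?_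
    simp only [hG]
    rw [sum_indicator_grid (fun i => κ * atomMass κ M P (i * δ)) hi hs, ← mul_sub, abs_mul,
      abs_of_nonneg hκ]
  have hGi : ∀ a b, IntervalIntegrable (fun s => |G s|) volume a b := by
    intro a b
    have h1 : ∀ i ∈ Finset.range n, IntervalIntegrable (fun s => κ * atomMass κ M P (i * δ) *
        (Ioo (i * δ) ((i + 1 : ℕ) * δ)).indicator 1 s) volume a b := fun i _ =>
      (Integrable.intervalIntegrable ((integrable_indicator_iff measurableSet_Ioo).2
        (integrableOn_const (by simp)))).const_mul _
    have h2 := (intervalIntegrable_mul_atomMass (κ := κ) P a b).sub (IntervalIntegrable.sum _ h1)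
    simp only [Finset.sum_fn] at h2
    exact h2.abs
  have hsum := intervalIntegral.sum_integral_adjacent_intervals (f := fun s => |G s|)
    (μ := volume) (a := fun i : ℕ => (i : ℝ) * δ) (n := n) fun k _ => hGi _ _
  rw [Nat.cast_zero, zero_mul, hn] at hsum
  have hbd := sum_integral_abs_sub_le (n := n) hδ hpc
    (fun a b => (intervalIntegrable_balance (κ := κ) P a b).abs) (fun _ => abs_nonneg _)
    (fun a b hab => abs_atomMass_sub_le P hab)
  rw [hn] at hbd
  have hnorm : ‖((localOp κ M hκ hM M - gridOp hκ hM n δ) P).snd‖ = ∫ s in (0 : ℝ)..M, |G s| := by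
    rw [L1.norm_eq_integral_norm, integral_congr_ae (hsnd.mono fun y hy => congrArg norm hy),
      setIntegral_Ioo_eq_intervalIntegral hM]
    have := intervalIntegral.integral_comp_sub_left (a := 0) (b := M) (fun s => |G s|) M
    rw [sub_self, sub_zero] at this
    exact this
  rw [norm_state, hfst, hnorm, ← hsum, abs_zero, zero_add,
    Finset.sum_congr rfl fun i hi => hcell i (Finset.mem_range.1 hi), ← Finset.mul_sum]
  calc _ ≤ κ * (δ * ((1 + κ * M) * ‖P‖)) := by
        gcongr
        refine hbd.trans ?_
        gcongr
        exact integral_abs_balance_le hκ hM P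
    _ = _ := by ring

/-- Transport over the full transit time `M` is compact: the new profile consists of values of the
absolutely continuous function `p`, so it is a limit of finite-rank operators. -/
theorem isCompactOperator_localOp : IsCompactOperator (localOp κ M hκ hM M) := by
  refine isCompactOperator_of_tendsto (l := atTop)
    (F := fun n : ℕ => gridOp hκ hM (n + 1) (M / ((n : ℝ) + 1))) ?_
    (Eventually.of_forall fun n => isCompactOperator_gridOp _ _)
  rw [tendsto_iff_norm_sub_tendsto_zero]
  have hlim : Tendsto (fun n : ℕ => κ * (M * (1 / ((n : ℝ) + 1))) * (1 + κ * M)) atTop (𝓝 0) := by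
    have := ((tendsto_one_div_add_atTop_nhds_zero_nat (𝕜 := ℝ)).const_mul M).const_mul κ
    simpa using this.mul_const (1 + κ * M)
  refine squeeze_zero (fun _ => norm_nonneg _) (fun n => ?_) hlim
  rw [norm_sub_rev, mul_one_div]
  refine norm_localOp_sub_gridOp_le (by positivity) ?_
  push_cast
  field_simp

end Compact

/-! ### The travel-time coordinate -/

section TravelTime

variable {L : ℝ} {p : ℝ → ℝ}

/-- The density `p` on `(0, L)`, extended by one to a positive function on the line. -/
noncomputable def extendedDensity (L : ℝ) (p : ℝ → ℝ) (x : ℝ) : ℝ :=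
  open Classical in (Ioo 0 L).piecewise p 1 x

theorem extendedDensity_of_mem {x : ℝ} (hx : x ∈ Ioo 0 L) : extendedDensity L p x = p x := by
  simp [extendedDensity, hx.1, hx.2]

theorem extendedDensity_of_notMem {x : ℝ} (hx : x ∉ Ioo 0 L) : extendedDensity L p x = 1 :=
  piecewise_eq_of_notMem _ _ _ hx

theorem extendedDensity_pos (hpos : ∀ x ∈ Ioo 0 L, 0 < p x) (x : ℝ) :
    0 < extendedDensity L p x := by
  by_cases hx : x ∈ Ioo 0 L
  · rw [extendedDensity_of_mem hx]
    exact hpos x hx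
  · rw [extendedDensity_of_notMem hx]
    exact one_pos

theorem measurable_extendedDensity (hp : ContinuousOn p (Icc 0 L)) :
    Measurable (extendedDensity L p) := by
  classical
  have h := ContinuousOn.measurable_piecewise (f := p) (g := 1) (hp.mono Ioo_subset_Icc_self)
    (continuousOn_const (c := (1 : ℝ))) measurableSet_Ioo
  convert h using 1
  ext x
  simp [extendedDensity, piecewise]

theorem intervalIntegrable_extendedDensity (hp : ContinuousOn p (Icc 0 L)) (a b : ℝ) :
    IntervalIntegrable (extendedDensity L p) volume a b := by
  have h1 : IntervalIntegrable ((Ioo 0 L).indicator p) volume a b :=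
    ((integrable_indicator_iff measurableSet_Ioo).2
      (hp.integrableOn_Icc.mono_set Ioo_subset_Icc_self)).intervalIntegrable
  have h2 : IntervalIntegrable ((Ioo 0 L)ᶜ.indicator fun _ : ℝ => (1 : ℝ)) volume a b := by
    rw [intervalIntegrable_iff, IntegrableOn, integrable_indicator_iff measurableSet_Ioo.compl]
    have h : IntegrableOn (fun _ : ℝ => (1 : ℝ)) (uIoc a b) := integrableOn_const (by simp [uIoc])
    exact Integrable.integrableOn h
  refine (h1.add h2).congr fun x _ => ?_
  by_cases hx : x ∈ Ioo 0 L
  · simp [extendedDensity_of_mem hx, indicator_of_mem hx,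
      indicator_of_notMem (notMem_compl_iff.2 hx)]
  · rw [extendedDensity_of_notMem hx, indicator_of_notMem hx,
      indicator_of_mem (mem_compl hx), zero_add]

/-- The time `∫₀ˣ p` that transport at speed `1 / p` takes from `0` to `x`. -/
noncomputable def travelTime (L : ℝ) (p : ℝ → ℝ) (x : ℝ) : ℝ :=
  ∫ t in (0 : ℝ)..x, extendedDensity L p t

theorem travelTime_sub (hp : ContinuousOn p (Icc 0 L)) (a b : ℝ) :
    travelTime L p b - travelTime L p a = ∫ t in a..b, extendedDensity L p t :=
  intervalIntegral.integral_interval_sub_left (intervalIntegrable_extendedDensity hp 0 b)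
    (intervalIntegrable_extendedDensity hp 0 a)

theorem travelTime_zero : travelTime L p 0 = 0 := intervalIntegral.integral_same

theorem travelTime_L (hL : 0 ≤ L) : travelTime L p L = ∫ x in Ioo 0 L, p x := by
  rw [travelTime, ← setIntegral_Ioo_eq_intervalIntegral hL]
  exact setIntegral_congr_fun measurableSet_Ioo fun x hx => extendedDensity_of_mem hx

theorem continuous_travelTime (hp : ContinuousOn p (Icc 0 L)) : Continuous (travelTime L p) :=
  intervalIntegral.continuous_primitive (intervalIntegrable_extendedDensity hp) 0

theorem strictMono_travelTime (hp : ContinuousOn p (Icc 0 L)) (hpos : ∀ x ∈ Ioo 0 L, 0 < p x) :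
    StrictMono (travelTime L p) := fun a b hab => by
  rw [← sub_pos, travelTime_sub hp]
  exact intervalIntegral.intervalIntegral_pos_of_pos (intervalIntegrable_extendedDensity hp a b)
    (extendedDensity_pos hpos) hab

theorem travelTime_of_nonpos {x : ℝ} (hx : x ≤ 0) : travelTime L p x = x := by
  have : ∫ t in (0 : ℝ)..x, extendedDensity L p t = ∫ _ in (0 : ℝ)..x, (1 : ℝ) := by
    refine intervalIntegral.integral_congr fun t ht => extendedDensity_of_notMem fun h => ?_
    rw [uIcc_of_ge hx] at ht
    linarith [h.1, ht.2]
  rw [travelTime, this]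
  simp

theorem travelTime_of_ge (hp : ContinuousOn p (Icc 0 L)) {x : ℝ} (hx : L ≤ x) :
    travelTime L p x = travelTime L p L + (x - L) := by
  have : ∫ t in L..x, extendedDensity L p t = ∫ _ in L..x, (1 : ℝ) := by
    refine intervalIntegral.integral_congr fun t ht => extendedDensity_of_notMem fun h => ?_
    rw [uIcc_of_le hx] at ht
    linarith [h.2, ht.1]
  rw [← sub_eq_iff_eq_add', travelTime_sub hp, this]
  simp

theorem surjective_travelTime (hp : ContinuousOn p (Icc 0 L)) :
    Function.Surjective (travelTime L p) := by
  refine (continuous_travelTime hp).surjective ?_ ?_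
  · have h : Tendsto (fun x => travelTime L p L + (x - L)) atTop atTop :=
      tendsto_atTop_add_const_left _ _ (tendsto_atTop_add_const_right _ _ tendsto_id)
    refine h.congr' ?_
    filter_upwards [eventually_ge_atTop L] with x hx
    exact (travelTime_of_ge hp hx).symm
  · refine tendsto_id.congr' ?_
    filter_upwards [eventually_le_atBot (0 : ℝ)] with x hx
    exact (travelTime_of_nonpos hx).symm

/-- The travel time as a homeomorphism of the line. -/
noncomputable def travelTimeHomeo (hp : ContinuousOn p (Icc 0 L))
    (hpos : ∀ x ∈ Ioo 0 L, 0 < p x) : ℝ ≃ₜ ℝ :=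
  (StrictMono.orderIsoOfSurjective _ (strictMono_travelTime hp hpos)
    (surjective_travelTime hp)).toHomeomorph

theorem measurableEmbedding_travelTime (hp : ContinuousOn p (Icc 0 L))
    (hpos : ∀ x ∈ Ioo 0 L, 0 < p x) : MeasurableEmbedding (travelTime L p) :=
  (travelTimeHomeo hp hpos).measurableEmbedding

theorem travelTime_preimage_Ioo (hp : ContinuousOn p (Icc 0 L)) (hpos : ∀ x ∈ Ioo 0 L, 0 < p x)
    (a b : ℝ) : travelTime L p ⁻¹' Ioo (travelTime L p a) (travelTime L p b) = Ioo a b := by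
  ext x
  simp [(strictMono_travelTime hp hpos).lt_iff_lt]

theorem travelTime_preimage_Ioo_zero (hp : ContinuousOn p (Icc 0 L))
    (hpos : ∀ x ∈ Ioo 0 L, 0 < p x) (b : ℝ) :
    travelTime L p ⁻¹' Ioo 0 (travelTime L p b) = Ioo 0 b := by
  simpa only [travelTime_zero] using travelTime_preimage_Ioo hp hpos 0 b

/-- The extended density with values in `ℝ≥0`. -/
noncomputable def densityNNReal (L : ℝ) (p : ℝ → ℝ) (x : ℝ) : ℝ≥0 :=
  (extendedDensity L p x).toNNReal

theorem measurable_densityNNReal (hp : ContinuousOn p (Icc 0 L)) :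
    Measurable (densityNNReal L p) := (measurable_extendedDensity hp).real_toNNReal

theorem densityNNReal_ne_zero (hpos : ∀ x ∈ Ioo 0 L, 0 < p x) (x : ℝ) :
    densityNNReal L p x ≠ 0 := (Real.toNNReal_pos.2 (extendedDensity_pos hpos x)).ne'

theorem densityNNReal_smul (hpos : ∀ x ∈ Ioo 0 L, 0 < p x) (x c : ℝ) :
    densityNNReal L p x • c = extendedDensity L p x * c := by
  rw [NNReal.smul_def, densityNNReal, Real.coe_toNNReal _ (extendedDensity_pos hpos x).le,
    smul_eq_mul]

/-- The travel time pushes the measure `p dx` forward to Lebesgue measure. -/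
theorem measurePreserving_travelTime (hp : ContinuousOn p (Icc 0 L))
    (hpos : ∀ x ∈ Ioo 0 L, 0 < p x) :
    MeasurePreserving (travelTime L p) (volume.withDensity fun x => densityNNReal L p x)
      volume := by
  refine ⟨(continuous_travelTime hp).measurable, (Real.measure_ext_Ioo_rat fun a b => ?_).symm⟩
  obtain ⟨a', ha⟩ := surjective_travelTime hp (a : ℝ)
  obtain ⟨b', hb⟩ := surjective_travelTime hp (b : ℝ)
  rw [Measure.map_apply (continuous_travelTime hp).measurable measurableSet_Ioo, ← ha, ← hb,
    travelTime_preimage_Ioo hp hpos, withDensity_apply _ measurableSet_Ioo, Real.volume_Ioo,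
    travelTime_sub hp]
  rcases le_or_gt a' b' with h | h
  · rw [intervalIntegral.integral_of_le h, integral_Ioc_eq_integral_Ioo,
      ofReal_integral_eq_lintegral_ofReal]
    · rfl
    · have := intervalIntegrable_extendedDensity hp a' b'
      rw [intervalIntegrable_iff, uIoc_of_le h] at this
      exact this.mono_set Ioo_subset_Ioc_self
    · exact Eventually.of_forall fun x => (extendedDensity_pos hpos x).le
  · rw [Ioo_eq_empty (not_lt.2 h.le), Measure.restrict_empty, lintegral_zero_measure,
      ← travelTime_sub hp, ENNReal.ofReal_eq_zero]
    exact sub_nonpos.2 ((strictMono_travelTime hp hpos).monotone h.le)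

variable {M : ℝ}

theorem measurePreserving_travelTime_restrict (hL : 0 ≤ L) (hp : ContinuousOn p (Icc 0 L))
    (hpos : ∀ x ∈ Ioo 0 L, 0 < p x) (hM : ∫ x in Ioo 0 L, p x = M) :
    MeasurePreserving (travelTime L p)
      ((volume.restrict (Ioo 0 L)).withDensity fun x => densityNNReal L p x)
      (volume.restrict (Ioo 0 M)) := by
  have h := (measurePreserving_travelTime hp hpos).restrict_preimage
    (measurableSet_Ioo (a := (0 : ℝ)) (b := M))
  rw [restrict_withDensity] at h
  · rwa [← hM, ← travelTime_L hL, travelTime_preimage_Ioo_zero hp hpos, travelTime_L hL, hM] at h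
  · exact (continuous_travelTime hp).measurable measurableSet_Ioo

theorem ae_comp_travelTime_iff (hL : 0 ≤ L) (hp : ContinuousOn p (Icc 0 L))
    (hpos : ∀ x ∈ Ioo 0 L, 0 < p x) (hM : ∫ x in Ioo 0 L, p x = M) {Q : ℝ → Prop} :
    (∀ᵐ x ∂(volume.restrict (Ioo 0 L)), Q (travelTime L p x)) ↔
      ∀ᵐ y ∂(volume.restrict (Ioo 0 M)), Q y := by
  rw [← (measurePreserving_travelTime_restrict hL hp hpos hM).map_eq,
    (measurableEmbedding_travelTime hp hpos).ae_map_iff,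
    ae_withDensity_iff (measurable_densityNNReal hp).coe_nnreal_ennreal]
  simp [densityNNReal_ne_zero hpos]

/-- The isometry `q ↦ p · (q ∘ τ)`, `τ` the travel time, from `L¹(0, M)` to `L¹(0, L)`. -/
noncomputable def travelTimeLI (hL : 0 ≤ L) (hp : ContinuousOn p (Icc 0 L))
    (hpos : ∀ x ∈ Ioo 0 L, 0 < p x) (hM : ∫ x in Ioo 0 L, p x = M) :
    L1Space M →ₗᵢ[ℝ] L1Space L :=
  (withDensitySMulLI (volume.restrict (Ioo 0 L)) (measurable_densityNNReal hp)).comp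
    (Lp.compMeasurePreservingₗᵢ ℝ (travelTime L p)
      (measurePreserving_travelTime_restrict hL hp hpos hM))

theorem travelTimeLI_coeFn (hL : 0 ≤ L) (hp : ContinuousOn p (Icc 0 L))
    (hpos : ∀ x ∈ Ioo 0 L, 0 < p x) (hM : ∫ x in Ioo 0 L, p x = M) (q : L1Space M) :
    travelTimeLI hL hp hpos hM q =ᵐ[volume.restrict (Ioo 0 L)]
      fun x => p x * q (travelTime L p x) := by
  have hmp := measurePreserving_travelTime_restrict hL hp hpos hM
  have h1 := Lp.coeFn_compMeasurePreserving q hmp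
  rw [Filter.EventuallyEq, ae_withDensity_iff
    (measurable_densityNNReal hp).coe_nnreal_ennreal] at h1
  filter_upwards [(memL1_smul_of_L1_withDensity (measurable_densityNNReal hp)
    (Lp.compMeasurePreserving _ hmp q)).coeFn_toLp, h1, ae_restrict_mem measurableSet_Ioo]
    with x h2 h3 hx
  refine h2.trans ?_
  rw [h3 (by simp [densityNNReal_ne_zero hpos]), densityNNReal_smul hpos,
    extendedDensity_of_mem hx, Function.comp_apply]

theorem surjective_travelTimeLI (hL : 0 ≤ L) (hp : ContinuousOn p (Icc 0 L))
    (hpos : ∀ x ∈ Ioo 0 L, 0 < p x) (hM : ∫ x in Ioo 0 L, p x = M) :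
    Function.Surjective (travelTimeLI hL hp hpos hM) := by
  intro f
  set σ := (travelTimeHomeo hp hpos).symm with hσ
  have hinv : ∀ x, σ (travelTime L p x) = x := (travelTimeHomeo hp hpos).symm_apply_apply
  set g : ℝ → ℝ := fun y => (extendedDensity L p (σ y))⁻¹ * f (σ y) with hg
  have hgi : Integrable g (volume.restrict (Ioo 0 M)) := by
    rw [← (measurePreserving_travelTime_restrict hL hp hpos hM).integrable_comp_emb
      (measurableEmbedding_travelTime hp hpos),
      integrable_withDensity_iff_integrable_smul (measurable_densityNNReal hp)]
    refine f.integrableOn.congr (Eventually.of_forall fun x => ?_)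
    simp only [Function.comp_apply, hg, hinv, densityNNReal_smul hpos]
    rw [mul_inv_cancel_left₀ (extendedDensity_pos hpos x).ne']
  refine ⟨(memLp_one_iff_integrable.2 hgi).toLp g, Lp.ext ?_⟩
  refine (travelTimeLI_coeFn hL hp hpos hM _).trans ?_
  filter_upwards [(ae_comp_travelTime_iff hL hp hpos hM).2
    (MemLp.coeFn_toLp (memLp_one_iff_integrable.2 hgi)), ae_restrict_mem measurableSet_Ioo]
    with x h1 hx
  rw [h1]
  simp only [hg, hinv, extendedDensity_of_mem hx]
  rw [mul_inv_cancel_left₀ (hpos x hx).ne']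

/-- The isometric isomorphism of `L¹(0, M)` and `L¹(0, L)` given by the travel time. -/
noncomputable def travelTimeEquiv (hL : 0 ≤ L) (hp : ContinuousOn p (Icc 0 L))
    (hpos : ∀ x ∈ Ioo 0 L, 0 < p x) (hM : ∫ x in Ioo 0 L, p x = M) :
    L1Space M ≃ₗᵢ[ℝ] L1Space L :=
  LinearIsometryEquiv.ofSurjective (travelTimeLI hL hp hpos hM)
    (surjective_travelTimeLI hL hp hpos hM)

theorem travelTimeEquiv_coeFn (hL : 0 ≤ L) (hp : ContinuousOn p (Icc 0 L))
    (hpos : ∀ x ∈ Ioo 0 L, 0 < p x) (hM : ∫ x in Ioo 0 L, p x = M) (q : L1Space M) :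
    travelTimeEquiv hL hp hpos hM q =ᵐ[volume.restrict (Ioo 0 L)]
      fun x => p x * q (travelTime L p x) :=
  travelTimeLI_coeFn hL hp hpos hM q

theorem integral_travelTimeEquiv (hL : 0 ≤ L) (hp : ContinuousOn p (Icc 0 L))
    (hpos : ∀ x ∈ Ioo 0 L, 0 < p x) (hM : ∫ x in Ioo 0 L, p x = M) (q : L1Space M) {x : ℝ}
    (hx : x ∈ Icc 0 L) :
    ∫ t in (0 : ℝ)..x, travelTimeEquiv hL hp hpos hM q t =
      ∫ y in (0 : ℝ)..travelTime L p x, q y := by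
  have hx0 : 0 ≤ travelTime L p x := by
    rw [← travelTime_zero (L := L) (p := p)]
    exact (strictMono_travelTime hp hpos).monotone hx.1
  rw [intervalIntegral_congr_ae_Ioo hx (travelTimeEquiv_coeFn hL hp hpos hM q),
    ← setIntegral_Ioo_eq_intervalIntegral hx.1, ← setIntegral_Ioo_eq_intervalIntegral hx0,
    ← (measurePreserving_travelTime hp hpos).setIntegral_preimage_emb
      (measurableEmbedding_travelTime hp hpos) (fun y => q y) (Ioo 0 (travelTime L p x))]
  rw [travelTime_preimage_Ioo_zero hp hpos, setIntegral_withDensity_eq_setIntegral_smul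
    (measurable_densityNNReal hp) _ measurableSet_Ioo]
  refine setIntegral_congr_fun measurableSet_Ioo fun t ht => ?_
  simp only [densityNNReal_smul hpos, extendedDensity_of_mem ⟨ht.1, ht.2.trans_le hx.2⟩]

end TravelTime

/-! ### The graph of the closed-loop operator -/

section Graph

variable {L lam p0s : ℝ} {p1s : ℝ → ℝ}

theorem IsDesiredState.value_zero_pos (hL : 0 < L) (hP : IsDesiredState L lam p0s p1s) :
    0 < p1s 0 := by
  have hv := hP.memW11.integrableOn_weakDeriv
  obtain ⟨c, hc⟩ := hP.memW11.hasWeakDeriv.ae_eq_primitive hL hP.memW11.1 hv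
  have he := hP.continuousOn.eqOn_Icc_of_ae_eq hL (continuousOn_primitive_Icc hL.le hv c) hc
  have hmid : L / 2 ∈ Ioo 0 L := ⟨by linarith, by linarith⟩
  have h1 := he (left_mem_Icc.2 hL.le)
  have h2 := he (Ioo_subset_Icc_self hmid)
  have h3 : ∫ t in (0 : ℝ)..L / 2, weakDeriv L p1s t ≤ 0 := by
    rw [← setIntegral_Ioo_eq_intervalIntegral hmid.1.le]
    refine integral_nonpos_of_ae ?_
    filter_upwards [ae_restrict_of_ae_restrict_of_subset (Ioo_subset_Ioo_right hmid.2.le)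
      hP.deriv_neg] with t ht using ht.le
  simp only [intervalIntegral.integral_same, add_zero] at h1
  have := hP.pos _ hmid
  linarith

theorem IsDesiredState.p0s_pos (hL : 0 < L) (hlam : 0 < lam)
    (hP : IsDesiredState L lam p0s p1s) : 0 < p0s := by
  have h := hP.value_zero_pos hL
  rw [hP.value_zero] at h
  exact (pos_iff_pos_of_mul_pos h).1 hlam

theorem ae_eq_mul_gMul (hP : IsDesiredState L lam p0s p1s) (P : StateSpace L) {v : ℝ → ℝ} :
    gMul L p1s P =ᵐ[volume.restrict (Ioo 0 L)] v ↔
      P.snd =ᵐ[volume.restrict (Ioo 0 L)] fun x => p1s x * v x := by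
  refine eventually_congr ?_
  filter_upwards [ae_restrict_mem measurableSet_Ioo] with x hx
  have := (hP.pos x hx).ne'
  rw [gMul, one_div, inv_mul_eq_iff_eq_mul₀ this]

theorem closedLoopOperator_apply_eq_iff {P Z : StateSpace L}
    (hx : P ∈ (closedLoopOperator L lam p1s).domain) :
    closedLoopOperator L lam p1s ⟨P, hx⟩ = Z ↔
      Z.fst = (∫ x in Ioo 0 L, weakDeriv L (gMul L p1s P) x) ∧
      Z.snd =ᵐ[volume.restrict (Ioo 0 L)] fun x => -weakDeriv L (gMul L p1s P) x := by
  have hsnd : (closedLoopOperator L lam p1s ⟨P, hx⟩).snd =ᵐ[volume.restrict (Ioo 0 L)]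
      fun x => -weakDeriv L (gMul L p1s P) x := by
    have hm := memLp_one_iff_integrable.2 hx.1.integrableOn_weakDeriv
    filter_upwards [Lp.coeFn_neg (hm.toLp _), hm.coeFn_toLp] with x h1 h2
    refine h1.trans ?_
    rw [Pi.neg_apply, h2]
  constructor
  · rintro rfl
    exact ⟨rfl, hsnd⟩
  · rintro ⟨h1, h2⟩
    exact StateSpace.ext h1.symm (hsnd.trans h2.symm)

/-- A pair `(P, Z)` lies in the graph of the closed-loop operator if and only if `Z` has total
mass zero and the flux `g p₁` is the primitive of `-z₁` with initial value `p₀ / p₀*`. -/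
theorem closedLoop_graph_iff (hL : 0 < L) (hlam : 0 < lam) (hP : IsDesiredState L lam p0s p1s)
    (P Z : StateSpace L) :
    (∃ hx : P ∈ (closedLoopOperator L lam p1s).domain,
      closedLoopOperator L lam p1s ⟨P, hx⟩ = Z) ↔
    Z.fst = -(∫ x in (0 : ℝ)..L, Z.snd x) ∧ P.snd =ᵐ[volume.restrict (Ioo 0 L)]
      fun x => p1s x * (p0s⁻¹ * P.fst - ∫ r in (0 : ℝ)..x, Z.snd r) := by
  have hp0 := hP.p0s_pos hL hlam
  have hprim : ∀ c, (fun x => c + ∫ r in (0 : ℝ)..x, -Z.snd r) =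
      fun x => c - ∫ r in (0 : ℝ)..x, Z.snd r := fun c => by
    ext x
    rw [intervalIntegral.integral_neg, sub_eq_add_neg]
  have hZ : IntegrableOn (fun x => -Z.snd x) (Ioo 0 L) := Z.snd.integrableOn.neg
  have hcont : ∀ c, ContinuousOn (fun x => p1s x * (c - ∫ r in (0 : ℝ)..x, Z.snd r)) (Icc 0 L) := by
    intro c
    have := continuousOn_primitive_Icc hL.le hZ c
    rw [hprim] at this
    exact hP.continuousOn.mul this
  constructor
  · rintro ⟨hx, hA⟩
    obtain ⟨h1, h2⟩ := (closedLoopOperator_apply_eq_iff hx).1 hA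
    have hw : weakDeriv L (gMul L p1s P) =ᵐ[volume.restrict (Ioo 0 L)] fun x => -Z.snd x := by
      filter_upwards [h2] with x hx
      rw [hx, neg_neg]
    refine ⟨?_, ?_⟩
    · rw [h1, integral_congr_ae hw, integral_neg, setIntegral_Ioo_eq_intervalIntegral hL.le]
    · have hx' := hx
      obtain ⟨hW, w, hwc, hwe, hw0⟩ := hx'
      have hwd : HasWeakDeriv L (gMul L p1s P) fun x => -Z.snd x := by
        intro φ h3 h4 h5
        rw [hW.hasWeakDeriv φ h3 h4 h5, neg_inj]
        refine integral_congr_ae ?_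
        filter_upwards [hw] with x hx
        rw [hx]
      obtain ⟨c, hc⟩ := hwd.ae_eq_primitive hL hW.1 hZ
      rw [hprim, ae_eq_mul_gMul hP] at hc
      -- The boundary condition `p₁(0) = λ p₀` fixes the constant, as `p₁*(0) = λ p₀*`.
      have h6 := hwc.eqOn_Icc_of_ae_eq hL (hcont c) (hwe.symm.trans hc) (left_mem_Icc.2 hL.le)
      simp only [intervalIntegral.integral_same, sub_zero, hw0, hP.value_zero] at h6
      have h7 : c = p0s⁻¹ * P.fst := by
        rw [mul_assoc] at h6
        have h8 := mul_left_cancel₀ hlam.ne' h6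
        rw [h8, inv_mul_cancel_left₀ hp0.ne']
      rw [← h7]
      exact hc
  · rintro ⟨h1, h2⟩
    have hg := (ae_eq_mul_gMul hP P).2 h2
    have hd := hasWeakDeriv_primitive hL.le hZ (p0s⁻¹ * P.fst)
    have hi := integrableOn_Ioo_primitive hL.le hZ (p0s⁻¹ * P.fst)
    rw [hprim] at hd hi
    have hd' := hd.congr hg.symm
    have hW : MemW11 L (gMul L p1s P) := ⟨hi.congr hg.symm, _, hZ, hd'⟩
    have hx : P ∈ (closedLoopOperator L lam p1s).domain := by
      refine ⟨hW, _, hcont (p0s⁻¹ * P.fst), h2, ?_⟩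
      simp only [intervalIntegral.integral_same, sub_zero, hP.value_zero]
      rw [mul_assoc, mul_inv_cancel_left₀ hp0.ne']
    have hw := hW.hasWeakDeriv.unique hW.integrableOn_weakDeriv hZ hd'
    refine ⟨hx, (closedLoopOperator_apply_eq_iff hx).2 ⟨?_, ?_⟩⟩
    · rw [h1, integral_congr_ae hw, integral_neg, setIntegral_Ioo_eq_intervalIntegral hL.le]
    · filter_upwards [hw] with x hx
      rw [hx, neg_neg]

end Graph

/-! ### The closed-loop semigroup -/

section ClosedLoop

variable {L M lam p0s : ℝ} {p1s : ℝ → ℝ}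

theorem IsDesiredState.mass_pos (hL : 0 < L) (hP : IsDesiredState L lam p0s p1s) :
    0 < ∫ x in Ioo 0 L, p1s x := by
  rw [← travelTime_L hL.le, ← travelTime_zero (L := L) (p := p1s)]
  exact strictMono_travelTime hP.continuousOn hP.pos hL

/-- The isometric isomorphism of state spaces induced by one of the spaces of profiles. -/
noncomputable def stateCongr (V : L1Space M ≃ₗᵢ[ℝ] L1Space L) : StateSpace M ≃ₗᵢ[ℝ] StateSpace L :=
  LinearIsometryEquiv.withLpProdCongr 1 (LinearIsometryEquiv.refl ℝ ℝ) V

theorem stateCongr_fst (V : L1Space M ≃ₗᵢ[ℝ] L1Space L) (P : StateSpace M) :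
    (stateCongr V P).fst = P.fst := by
  rw [stateCongr, LinearIsometryEquiv.withLpProdCongr_apply, WithLp.toLp_fst]
  simp

theorem stateCongr_snd (V : L1Space M ≃ₗᵢ[ℝ] L1Space L) (P : StateSpace M) :
    (stateCongr V P).snd = V P.snd := by
  rw [stateCongr, LinearIsometryEquiv.withLpProdCongr_apply, WithLp.toLp_snd]

/-- The isometric isomorphism of the state spaces given by the travel time. -/
noncomputable def stateEquiv (hL : 0 < L) (hP : IsDesiredState L lam p0s p1s)
    (hM : ∫ x in Ioo 0 L, p1s x = M) : StateSpace M ≃ₗᵢ[ℝ] StateSpace L :=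
  stateCongr (travelTimeEquiv hL.le hP.continuousOn hP.pos hM)

theorem stateEquiv_fst (hL : 0 < L) (hP : IsDesiredState L lam p0s p1s)
    (hM : ∫ x in Ioo 0 L, p1s x = M) (P : StateSpace M) :
    (stateEquiv hL hP hM P).fst = P.fst :=
  stateCongr_fst _ P

theorem stateEquiv_snd (hL : 0 < L) (hP : IsDesiredState L lam p0s p1s)
    (hM : ∫ x in Ioo 0 L, p1s x = M) (P : StateSpace M) : (stateEquiv hL hP hM P).snd =
      travelTimeEquiv hL.le hP.continuousOn hP.pos hM P.snd :=
  stateCongr_snd _ P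

theorem graph_stateEquiv_iff (hL : 0 < L) (hP : IsDesiredState L lam p0s p1s)
    (hM : ∫ x in Ioo 0 L, p1s x = M) (κ : ℝ) (P Z : StateSpace M) :
    ((stateEquiv hL hP hM Z).fst = -(∫ x in (0 : ℝ)..L, (stateEquiv hL hP hM Z).snd x) ∧
      (stateEquiv hL hP hM P).snd =ᵐ[volume.restrict (Ioo 0 L)] fun x => p1s x *
        (κ * (stateEquiv hL hP hM P).fst - ∫ r in (0 : ℝ)..x, (stateEquiv hL hP hM Z).snd r)) ↔
    (Z.fst = -(∫ y in (0 : ℝ)..M, Z.snd y) ∧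
      P.snd =ᵐ[volume.restrict (Ioo 0 M)]
        fun y => κ * P.fst - ∫ r in (0 : ℝ)..y, Z.snd r) := by
  have hint := fun x (hx : x ∈ Icc 0 L) =>
    integral_travelTimeEquiv hL.le hP.continuousOn hP.pos hM Z.snd hx
  rw [stateEquiv_fst, stateEquiv_fst, stateEquiv_snd, stateEquiv_snd,
    hint L (right_mem_Icc.2 hL.le), travelTime_L hL.le, hM]
  refine and_congr_right fun _ => ?_
  rw [Filter.EventuallyEq, Filter.EventuallyEq,
    ← ae_comp_travelTime_iff hL.le hP.continuousOn hP.pos hM]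
  refine eventually_congr ?_
  filter_upwards [travelTimeEquiv_coeFn hL.le hP.continuousOn hP.pos hM P.snd,
    ae_restrict_mem measurableSet_Ioo] with x h1 hx
  rw [h1, hint x (Ioo_subset_Icc_self hx), mul_right_inj' (hP.pos x hx).ne']

/-- Transport of states on `(0, L)`, read in the travel-time coordinate. -/
noncomputable def closedLoopLocalOp (hL : 0 < L) (hP : IsDesiredState L lam p0s p1s)
    (hM : ∫ x in Ioo 0 L, p1s x = M) (hM0 : 0 ≤ M) (t : ℝ) : StateSpace L →L[ℝ] StateSpace L :=
  ((stateEquiv hL hP hM).toContinuousLinearEquiv : StateSpace M →L[ℝ] StateSpace L).comp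
    ((localOp p0s⁻¹ M (inv_nonneg.2 hP.nonneg) hM0 t).comp
      ((stateEquiv hL hP hM).symm.toContinuousLinearEquiv : StateSpace L →L[ℝ] StateSpace M))

theorem closedLoopLocalOp_apply (hL : 0 < L) (hP : IsDesiredState L lam p0s p1s)
    (hM : ∫ x in Ioo 0 L, p1s x = M) (hM0 : 0 ≤ M) (t : ℝ) (P : StateSpace M) :
    closedLoopLocalOp hL hP hM hM0 t (stateEquiv hL hP hM P) =
      stateEquiv hL hP hM (localOp p0s⁻¹ M (inv_nonneg.2 hP.nonneg) hM0 t P) := by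
  simp [closedLoopLocalOp]

/-- The semigroup generated by the closed-loop operator. -/
noncomputable def closedLoopSemigroup (hL : 0 < L) (hP : IsDesiredState L lam p0s p1s)
    (hM : ∫ x in Ioo 0 L, p1s x = M) (hM0 : 0 < M) : C0Semigroup (StateSpace L) :=
  C0Semigroup.ofLocal (closedLoopLocalOp hL hP hM hM0.le) M hM0
    (ContinuousLinearMap.ext fun Q => by
      obtain ⟨P, rfl⟩ := (stateEquiv hL hP hM).surjective Q
      rw [closedLoopLocalOp_apply, localOp_zero]
      rfl)
    (fun s t hs ht hst => ContinuousLinearMap.ext fun Q => by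
      obtain ⟨P, rfl⟩ := (stateEquiv hL hP hM).surjective Q
      rw [mul_apply_eq_comp, closedLoopLocalOp_apply, closedLoopLocalOp_apply,
        closedLoopLocalOp_apply, localOp_add s t hs ht hst]
      rfl)
    (fun Q => by
      obtain ⟨P, rfl⟩ := (stateEquiv hL hP hM).surjective Q
      simp only [closedLoopLocalOp_apply]
      exact ((stateEquiv hL hP hM).continuous.tendsto P).comp (tendsto_localOp P))

theorem isGeneratedBy_closedLoopSemigroup (hL : 0 < L) (hlam : 0 < lam)
    (hP : IsDesiredState L lam p0s p1s) (hM : ∫ x in Ioo 0 L, p1s x = M) (hM0 : 0 < M) :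
    (closedLoopSemigroup hL hP hM hM0).IsGeneratedBy (closedLoopOperator L lam p1s) := by
  intro Q Y
  obtain ⟨P, rfl⟩ := (stateEquiv hL hP hM).surjective Q
  obtain ⟨Z, rfl⟩ := (stateEquiv hL hP hM).surjective Y
  rw [closedLoop_graph_iff hL hlam hP, graph_stateEquiv_iff]
  have h1 : (Z.fst = -(∫ y in (0 : ℝ)..M, Z.snd y) ∧ P.snd =ᵐ[volume.restrict (Ioo 0 M)]
      fun y => p0s⁻¹ * P.fst - ∫ r in (0 : ℝ)..y, Z.snd r) ↔
      Tendsto (fun h : ℝ≥0 => (h : ℝ)⁻¹ •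
        (localOp p0s⁻¹ M (inv_nonneg.2 hP.nonneg) hM0.le h P - P)) (𝓝[>] 0) (𝓝 Z) :=
    ⟨fun h => tendsto_quotient_of_graph hM0 h.1 h.2, graph_of_tendsto_quotient hM0⟩
  rw [h1, (stateEquiv hL hP hM).isometry.isEmbedding.tendsto_nhds_iff]
  refine tendsto_congr' ?_
  filter_upwards [nhdsWithin_le_nhds (eventually_nnreal_lt hM0)] with h hh
  rw [closedLoopSemigroup, C0Semigroup.ofLocal_op_of_lt hh, closedLoopLocalOp_apply,
    Function.comp_apply, map_smul, map_sub]

theorem isCompactOperator_closedLoopSemigroup (hL : 0 < L)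
    (hP : IsDesiredState L lam p0s p1s) (hM : ∫ x in Ioo 0 L, p1s x = M) (hM0 : 0 < M) {t : ℝ≥0}
    (ht : M ≤ t) : IsCompactOperator ((closedLoopSemigroup hL hP hM hM0).op t) := by
  obtain ⟨m, hm⟩ : ∃ m : ℝ≥0, (m : ℝ) = M := ⟨M.toNNReal, Real.coe_toNNReal _ hM0.le⟩
  have hmt : m ≤ t := by
    rw [← NNReal.coe_le_coe, hm]
    exact ht
  have hc : IsCompactOperator (closedLoopLocalOp hL hP hM hM0.le M) :=
    IsCompactOperator.clm_comp ((isCompactOperator_localOp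
      (hκ := inv_nonneg.2 hP.nonneg) (hM := hM0.le)).comp_clm
      ((stateEquiv hL hP hM).symm.toContinuousLinearEquiv : StateSpace L →L[ℝ] StateSpace M))
      ((stateEquiv hL hP hM).toContinuousLinearEquiv : StateSpace M →L[ℝ] StateSpace L)
  have hm' : (closedLoopSemigroup hL hP hM hM0).op m = closedLoopLocalOp hL hP hM hM0.le M :=
    C0Semigroup.ofLocal_op_self hm
  rw [← tsub_add_cancel_of_le hmt, C0Semigroup.op_add, hm']
  exact hc.clm_comp ((closedLoopSemigroup hL hP hM hM0).op (t - m))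

end ClosedLoop

theorem theorem3 (L lam p0s : ℝ) (p1s : ℝ → ℝ) (hL : 0 < L) (hlam : 0 < lam)
    (hP : IsDesiredState L lam p0s p1s) :
    ∃ T : C0Semigroup (StateSpace L),
      T.IsGeneratedBy (closedLoopOperator L lam p1s) ∧
      (∀ T' : C0Semigroup (StateSpace L),
        T'.IsGeneratedBy (closedLoopOperator L lam p1s) → T' = T) ∧
      ∀ t : ℝ≥0, max L (∫ x in Ioo 0 L, |p1s x|) < (t : ℝ) →
        IsCompactOperator (T.op t : StateSpace L → StateSpace L) := by
  have hT := isGeneratedBy_closedLoopSemigroup hL hlam hP rfl (hP.mass_pos hL)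
  refine ⟨_, hT, fun T' hT' => C0Semigroup.eq_of_isGeneratedBy hT hT', fun t ht => ?_⟩
  have habs : ∫ x in Ioo 0 L, |p1s x| = ∫ x in Ioo 0 L, p1s x :=
    setIntegral_congr_fun measurableSet_Ioo fun x hx => abs_of_pos (hP.pos x hx)
  refine isCompactOperator_closedLoopSemigroup hL hP rfl _ ?_
  rw [← habs]
  exact ((le_max_right _ _).trans_lt ht).le
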